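/- **Setting.** Let $1\le m\le n$ and $k\ge 1$. Consider the uncertain mechanical system $$M(q,\sigma,t)\ddot q+C(q,\dot q,\sigma,t)\dot q+g(q,\sigma,t)=B(q,\sigma,t)\tau,\qquad q\in\mathbb R^n,\ \tau\in\mathbb R^m,\ t\ge t_0\ge 0,$$ with $\sigma(t)\in\Sigma$ for a nonempty compact set $\Sigma\subset\mathbb R^p$ and $M$ symmetric positive definite, and nominal parts $\bar M$ (symmetric positive definite), $\bar C$, $\bar g$, $\bar B$. Let $\zeta=Aq=(q_{s_1},\dots,q_{s_m})^\top$ with $s_1<\dots<s_m$ (so $A$ is a constant $0$-$1$ selection matrix), and let the desired path be $\mathcal P=\{\zeta\in\mathbb R^m:\psi_i(\zeta)=0,\ i=1,\dots,m-1\}=\{f(w):w\in\mathbb R\}$ with $f_i\in C^2$ and $f_i'$ bounded. Put $\xi=(\zeta,w)\in\mathbb R^{m+1}$, $\phi_i(\xi)=\zeta_i-f_i(w)$, $\mathcal P^{hgh}=\{\xi:\phi(\xi)=0\}$, and, for gains $k_i>0$, $$\chi^{\rm s}_i(\zeta,w)=(-1)^mf_i'(w)-k_i\phi_i(\xi),\qquad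 \dot w=(-1)^m+\sum_{i=1}^m k_i\phi_i(\xi)f_i'(w),$$ $$\beta=A\dot q-\chi^{\rm s}(Aq,w),\qquad b=\frac{\partial \chi^{\rm s}(Aq,w)}{\partial q}\dot q+\frac{\partial\chi^{\rm s}(Aq,w)}{\partial w}\dot w .$$ Let $P\in\mathbb R^{m\times m}$ be symmetric positive definite, $\kappa,\mu,\varepsilon,\ell_1,\ell_2>0$, $G=A\bar M^{-1}\bar B$, and let $\lambda_m(\cdot)$ denote the least eigenvalue. For $X\in\{B-\bar B,\ C-\bar C,\ g-\bar g\}$ and $X=H:=\bar MM^{-1}-I$ write $\check B,\check C,\check g,\check H$ for the matched parts $G^{-1}A\bar M^{-1}X$, and put $W=\check B+\check HB$. The control is $\tau=p_1+p_2+p_3$ with $$p_1=G^{-1}\big[b+A\bar M^{-1}(\bar C\dot q+\bar g)\big],\quad p_2=-\kappa G^\top P\beta,\quad p_3=-\eta\,\upsilon\,\Pi(\hat\alpha,q,\dot q,w,t),$$ where $\Pi(\alpha,q,\dot q,w,t)=\alpha^\top\breve\Pi(q,\dot q,w,t)$ for a known entrywise nonnegative $\breve\Pi$ with values in $\mathbb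 R^k$, $\breve\beta=\bar B^\top\bar M^{-1}A^\top P\beta$, $\upsilon=\breve\beta\,\Pi(\hat\alpha,q,\dot q,w,t)$, and $\eta=1/\|\upsilon\|$ if $\|\upsilon\|>\mu$, $\eta=1/\mu$ otherwise. The adaptive law, with $\hat\alpha_i(t_0)>0$, is $$\dot{\hat\alpha}=\begin{cases}\ell_1\breve\Pi\|\breve\beta\|-\ell_2\hat\alpha,&\|\breve\Pi\|\|\breve\beta\|>\varepsilon,\\ \ell_1\breve\Pi\,\|\breve\Pi\|\|\breve\beta\|^2/\varepsilon-\ell_2\hat\alpha,&\text{otherwise.}\end{cases}$$ **Assumptions.** (i) $\|\phi(\xi)\|\to\infty$ as $\mathrm{dist}(\xi,\mathcal P^{hgh})\to\infty$. (ii) There is $\underline\lambda>0$ with $\lambda_m(PGG^\top P)\ge\underline\lambda$ for all $q$ and $t\ge0$. (iii) There is $\rho_W>-1$ with $\tfrac12\min_{\sigma\in\Sigma}\lambda_m(W+W^\top)\ge\rho_W$ for all $q$ and $t\ge 0$. (iv) There is $\alpha\in(0,\infty)^k$ such that for all $q,\dot q,w$ and $t\ge0$ $$(1+\rho_W)^{-1}\max_{\sigma\in\Sigma}\big\|\check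 H(-C\dot q-g+Bp_1)+\check Bp_1-\check C\dot q-\check g\big\|\le\Pi(\alpha,q,\dot q,w,t).$$ **Conclusion.** Along the closed-loop trajectories the path-following error $\mathrm{dist}(\zeta(t),\mathcal P)$ and the adaptive error $\|\hat\alpha(t)-\alpha\|$ are uniformly ultimately bounded. That is, for each of them there is a bound $c>0$ such that for every $r>0$ there is $T\ge0$, independent of $t_0$, $\sigma(\cdot)$ and the trajectory, for which the error is at most $c$ at all times $t\ge t_0+T$ at which the trajectory exists, whenever $\|\varphi(t_0)\|\le r$ and $\mathrm{dist}(\xi(t_0),\mathcal P^{hgh})\le r$; here $\varphi=(\beta,\hat\alpha-\alpha)\in\mathbb R^{m+k}$. Moreover, with $$K_1=\min\{2\kappa\underline\lambda(1+\rho_W),\,2(1+\rho_W)\ell_1^{-1}\ell_2\},\quad K_2=2(1+\rho_W)\ell_1^{-1}\ell_2\|\alpha\|,\quad K_3=\tfrac12(1+\rho_W)(\mu+\varepsilon\|\alpha\|),$$ $$R=\frac{K_2+\sqrt{K_2^2+4K_1K_3}}{2K_1},\quad \mathcal X_1=\min\{\lambda_{\min}(P),\ell_1^{-1}(1+\rho_W)\},\quad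 \mathcal X_2=\max\{\lambda_{\max}(P),\ell_1^{-1}(1+\rho_W)\},$$ one has $\|\varphi(t)\|\le\sqrt{\mathcal X_2/\mathcal X_1}\,\max\{R,\|\varphi(t_0)\|\}$ for all $t\ge t_0$ at which the trajectory exists, and for every $\bar d>\sqrt{\mathcal X_2/\mathcal X_1}\,R$ and every $s\ge\|\varphi(t_0)\|$ one has $\|\varphi(t)\|\le\bar d$ for all such $t\ge t_0+T(\bar d,s)$, where $$T(\bar d,s)=\begin{cases}0,& s\le\bar d\sqrt{\mathcal X_1/\mathcal X_2},\\[2pt] \dfrac{\mathcal X_2s^2-(\mathcal X_1^2/\mathcal X_2)\bar d^2}{K_1\bar d^2(\mathcal X_1/\mathcal X_2)-K_2\bar d(\mathcal X_1/\mathcal X_2)^{1/2}-K_3},&\text{otherwise.}\end{cases}$$ -/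

import Mathlib

open Matrix MeasureTheory Filter Topology

noncomputable section

namespace PathFollowing

/-- Coordinate vectors. Norms of such vectors are always taken with `nrm` below. -/
abbrev Vec (n : ℕ) : Type := Fin n → ℝ

/-- The Euclidean norm of a coordinate vector. -/
def nrm {ι : Type} [Fintype ι] (v : ι → ℝ) : ℝ := ‖(WithLp.toLp 2 v : EuclideanSpace ℝ ι)‖

/-- The Euclidean distance `inf {‖x - y‖ : y ∈ S}` from a point to a set. -/
def distTo {ι : Type} [Fintype ι] (x : ι → ℝ) (S : Set (ι → ℝ)) : ℝ :=
  sInf ((fun y => nrm (x - y)) '' S)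

/-- The least eigenvalue of a (symmetric, nonempty) real matrix. -/
def lamMin {m : ℕ} (S : Matrix (Fin m) (Fin m) ℝ) : ℝ := sInf (spectrum ℝ S)

/-- The largest eigenvalue of a (symmetric, nonempty) real matrix. -/
def lamMax {m : ℕ} (S : Matrix (Fin m) (Fin m) ℝ) : ℝ := sSup (spectrum ℝ S)

/-- The uncertain mechanical system
`M(q,σ,t) q'' + C(q,q',σ,t) q' + g(q,σ,t) = B(q,σ,t) τ`, with `σ(t)` ranging over the compact
set `unc` and with positive definite inertia matrix. -/
structure UncertainSystem (n m p : ℕ) where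
  unc : Set (Vec p)
  unc_compact : IsCompact unc
  unc_nonempty : unc.Nonempty
  M : Vec n → Vec p → ℝ → Matrix (Fin n) (Fin n) ℝ
  C : Vec n → Vec n → Vec p → ℝ → Matrix (Fin n) (Fin n) ℝ
  g : Vec n → Vec p → ℝ → Vec n
  B : Vec n → Vec p → ℝ → Matrix (Fin n) (Fin m) ℝ
  M_posDef : ∀ q, ∀ σ ∈ unc, ∀ t, 0 ≤ t → (M q σ t).PosDef

/-- The nominal parts of the system matrices. -/
structure NominalSystem (n m : ℕ) where
  Mbar : Vec n → ℝ → Matrix (Fin n) (Fin n) ℝ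
  Cbar : Vec n → Vec n → ℝ → Matrix (Fin n) (Fin n) ℝ
  gbar : Vec n → ℝ → Vec n
  Bbar : Vec n → ℝ → Matrix (Fin n) (Fin m) ℝ
  Mbar_posDef : ∀ q t, 0 ≤ t → (Mbar q t).PosDef

/-- The desired path: the common zero set in `ℝ^m` of `m - 1` functions `ψ i`, parametrized by a
`C²` curve `f` whose coordinate functions have bounded derivatives. It is a path for the
coordinates `q_{sel 1}, …, q_{sel m}` of the configuration `q ∈ ℝ^n`. -/
structure DesiredPath (n m : ℕ) where
  sel : Fin m ↪o Fin n
  ψ : Fin (m - 1) → Vec m → ℝ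
  f : Fin m → ℝ → ℝ
  f_contDiff : ∀ i, ContDiff ℝ 2 (f i)
  f_deriv_bdd : ∃ e : ℝ, 0 < e ∧ ∀ i w, |deriv (f i) w| ≤ e
  parametrized : {ζ : Vec m | ∀ i, ψ i ζ = 0} = Set.range (fun w i => f i w)

/-- Everything the controller knows: the nominal system, the desired path, the gains `kf i` of the
guiding vector field, the matrix `P`, the gain `κ`, the parameters of the adaptive robust action
and of the adaptive law, and the known vector-valued bounding function `env`. -/
structure Design (n m k : ℕ) extends NominalSystem n m, DesiredPath n m where
  kf : Fin m → ℝ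
  kf_pos : ∀ i, 0 < kf i
  P : Matrix (Fin m) (Fin m) ℝ
  P_posDef : P.PosDef
  κ : ℝ
  κ_pos : 0 < κ
  μ : ℝ
  μ_pos : 0 < μ
  ε : ℝ
  ε_pos : 0 < ε
  l1 : ℝ
  l1_pos : 0 < l1
  l2 : ℝ
  l2_pos : 0 < l2
  env : Vec n → Vec n → ℝ → ℝ → Vec k
  env_nonneg : ∀ q v w t i, 0 ≤ env q v w t i

namespace DesiredPath

variable {n m : ℕ} (D : DesiredPath n m)

/-- The desired path `𝒫 ⊆ ℝ^m`. -/
def path : Set (Vec m) := {ζ | ∀ i, D.ψ i ζ = 0}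

/-- The selection matrix with `A q = (q_{sel 1}, …, q_{sel m})`. -/
def A : Matrix (Fin m) (Fin n) ℝ := Matrix.of fun i j => if D.sel i = j then 1 else 0

/-- A point `ξ = (ζ, w)` of `ℝ^{m+1}`. -/
def ext (ζ : Vec m) (w : ℝ) : Fin m ⊕ Unit → ℝ := Sum.elim ζ (fun _ => w)

/-- The path functions `φ_i(ζ, w) = ζ_i - f_i(w)`. -/
def φ (ξ : Fin m ⊕ Unit → ℝ) : Vec m := fun i => ξ (Sum.inl i) - D.f i (ξ (Sum.inr ()))

/-- The lifted path in `ℝ^{m+1}`. -/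
def pathHgh : Set (Fin m ⊕ Unit → ℝ) := {ξ | ∀ i, D.φ ξ i = 0}

/-- Radial boundedness: `‖φ(ξ)‖ → ∞` as `dist(ξ, 𝒫ʰᵍʰ) → ∞`. -/
def RadiallyBounded : Prop :=
  Tendsto (fun ξ => nrm (D.φ ξ)) (comap (fun ξ => distTo ξ D.pathHgh) atTop) atTop

end DesiredPath

namespace Design

variable {n m k : ℕ} (D : Design n m k)

/-- The first `m` components of the guiding vector field. -/
def χs (ζ : Vec m) (w : ℝ) : Vec m := fun i =>
  (-1) ^ m * deriv (D.f i) w - D.kf i * D.φ (DesiredPath.ext ζ w) i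

/-- The last component of the guiding vector field, which drives the virtual coordinate `w`. -/
def χw (ζ : Vec m) (w : ℝ) : ℝ :=
  (-1) ^ m + ∑ i, D.kf i * D.φ (DesiredPath.ext ζ w) i * deriv (D.f i) w

/-- The derivative `b` of `χs (A q) w` along the motion. -/
def b (q v : Vec n) (w : ℝ) : Vec m :=
  fderiv ℝ (fun q' => D.χs (D.A *ᵥ q') w) q v
    + D.χw (D.A *ᵥ q) w • deriv (fun w' => D.χs (D.A *ᵥ q) w') w

/-- The constraint-following error `β`. -/
def β (q v : Vec n) (w : ℝ) : Vec m := D.A *ᵥ v - D.χs (D.A *ᵥ q) w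

/-- The matrix `A M̄⁻¹ B̄`. -/
def G (q : Vec n) (t : ℝ) : Matrix (Fin m) (Fin m) ℝ := D.A * (D.Mbar q t)⁻¹ * D.Bbar q t

/-- The matrix `(A M̄⁻¹ B̄)⁻¹ A M̄⁻¹` that extracts the matched part of an uncertainty. -/
def matched (q : Vec n) (t : ℝ) : Matrix (Fin m) (Fin n) ℝ :=
  (D.G q t)⁻¹ * (D.A * (D.Mbar q t)⁻¹)

/-- The feedforward part of the nominal control. -/
def p1 (q v : Vec n) (w t : ℝ) : Vec m :=
  (D.G q t)⁻¹ *ᵥ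
    (D.b q v w + (D.A * (D.Mbar q t)⁻¹) *ᵥ (D.Cbar q v t *ᵥ v + D.gbar q t))

/-- The feedback part of the nominal control. -/
def p2 (q v : Vec n) (w t : ℝ) : Vec m :=
  -(D.κ • (((D.G q t)ᵀ * D.P) *ᵥ D.β q v w))

/-- The envelope `Π(a,q,q',w,t) = aᵀ env(q,q',w,t)`. -/
def Env (a : Vec k) (q v : Vec n) (w t : ℝ) : ℝ := a ⬝ᵥ D.env q v w t

/-- The vector `B̄ᵀ M̄⁻¹ Aᵀ P β`. -/
def βbreve (q v : Vec n) (w t : ℝ) : Vec m :=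
  ((D.Bbar q t)ᵀ * (D.Mbar q t)⁻¹ * D.Aᵀ * D.P) *ᵥ D.β q v w

/-- The vector `υ = B̄ᵀ M̄⁻¹ Aᵀ P β Π`. -/
def υ (a : Vec k) (q v : Vec n) (w t : ℝ) : Vec m := D.Env a q v w t • D.βbreve q v w t

/-- The scalar `η`. -/
def η (a : Vec k) (q v : Vec n) (w t : ℝ) : ℝ :=
  if D.μ < nrm (D.υ a q v w t) then 1 / nrm (D.υ a q v w t) else 1 / D.μ

/-- The adaptive robust action. -/
def p3 (a : Vec k) (q v : Vec n) (w t : ℝ) : Vec m :=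
  -((D.η a q v w t * D.Env a q v w t) • D.υ a q v w t)

/-- The adaptive robust path-following control `τ = p1 + p2 + p3`. -/
def τ (a : Vec k) (q v : Vec n) (w t : ℝ) : Vec m :=
  D.p1 q v w t + D.p2 q v w t + D.p3 a q v w t

/-- The right-hand side of the leakage-type adaptive law. -/
def adaptRhs (a : Vec k) (q v : Vec n) (w t : ℝ) : Vec k :=
  if D.ε < nrm (D.env q v w t) * nrm (D.βbreve q v w t) then
    (D.l1 * nrm (D.βbreve q v w t)) • D.env q v w t - D.l2 • a
  else
    (D.l1 * (nrm (D.env q v w t) * nrm (D.βbreve q v w t) ^ 2 / D.ε)) • D.env q v w t - D.l2 • a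

/-- `λ_min(P A M̄⁻¹ B̄ (A M̄⁻¹ B̄)ᵀ P) ≥ lam` for all `(q, t)`. -/
def NominalGainBound (lam : ℝ) : Prop :=
  ∀ q t, 0 ≤ t → lam ≤ lamMin (D.P * D.G q t * (D.G q t)ᵀ * D.P)

variable {p : ℕ} (S : UncertainSystem n m p)

/-- `H = M̄ M⁻¹ - I`. -/
def H (q : Vec n) (σ : Vec p) (t : ℝ) : Matrix (Fin n) (Fin n) ℝ :=
  D.Mbar q t * (S.M q σ t)⁻¹ - 1

/-- The matched part of `H`. -/
def Hchk (q : Vec n) (σ : Vec p) (t : ℝ) : Matrix (Fin m) (Fin n) ℝ :=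
  D.matched q t * D.H S q σ t

/-- The matched part of `ΔB = B - B̄`. -/
def Bchk (q : Vec n) (σ : Vec p) (t : ℝ) : Matrix (Fin m) (Fin m) ℝ :=
  D.matched q t * (S.B q σ t - D.Bbar q t)

/-- The matched part of `ΔC = C - C̄`. -/
def Cchk (q v : Vec n) (σ : Vec p) (t : ℝ) : Matrix (Fin m) (Fin n) ℝ :=
  D.matched q t * (S.C q v σ t - D.Cbar q v t)

/-- The matched part of `Δg = g - ḡ`. -/
def gchk (q : Vec n) (σ : Vec p) (t : ℝ) : Vec m :=
  D.matched q t *ᵥ (S.g q σ t - D.gbar q t)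

/-- `W = B̌ + Ȟ B`. -/
def W (q : Vec n) (σ : Vec p) (t : ℝ) : Matrix (Fin m) (Fin m) ℝ :=
  D.Bchk S q σ t + D.Hchk S q σ t * S.B q σ t

/-- `½ min_{σ ∈ unc} λ_min(W + Wᵀ) ≥ ρ` for all `(q, t)`. -/
def InputUncertaintyBound (ρ : ℝ) : Prop :=
  ∀ q t, 0 ≤ t → ∀ σ ∈ S.unc, ρ ≤ 1 / 2 * lamMin (D.W S q σ t + (D.W S q σ t)ᵀ)

/-- The aggregated uncertainty is bounded by the envelope with parameter `α`:
`(1 + ρ)⁻¹ max_{σ ∈ unc} ‖Ȟ(-C q' - g + B p1) + (B̌ p1 - Č q' - ǧ)‖ ≤ Π(α,q,q',w,t)`. -/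
def EnvelopeBound (ρ : ℝ) (α : Vec k) : Prop :=
  ∀ (q v : Vec n) (w t : ℝ), 0 ≤ t → ∀ σ ∈ S.unc,
    (1 + ρ)⁻¹ * nrm
      (D.Hchk S q σ t *ᵥ (-(S.C q v σ t *ᵥ v) - S.g q σ t + S.B q σ t *ᵥ D.p1 q v w t)
        + (D.Bchk S q σ t *ᵥ D.p1 q v w t - D.Cchk S q v σ t *ᵥ v - D.gchk S q σ t))
      ≤ D.Env α q v w t

/-- A trajectory of the closed loop (uncertain system, virtual coordinate `w`, adaptive law) for
some uncertainty signal `σ`, started at time `t0 ≥ 0` and defined on an arbitrary interval `J`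
with left end point `t0`. Solutions are in the sense of Carathéodory: the velocity `v = q'` and the
adaptive parameter `a` are absolutely continuous on compact intervals and satisfy their differential
equations almost everywhere, so `σ` may jump. -/
structure Trajectory where
  t0 : ℝ
  t0_nonneg : 0 ≤ t0
  J : Set ℝ
  J_ordConnected : J.OrdConnected
  J_subset : J ⊆ Set.Ici t0
  t0_mem : t0 ∈ J
  σ : ℝ → Vec p
  σ_mem : ∀ t ∈ J, σ t ∈ S.unc
  q : ℝ → Vec n
  v : ℝ → Vec n
  w : ℝ → ℝ
  a : ℝ → Vec k
  q_deriv : ∀ t ∈ J, HasDerivWithinAt q (v t) J t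
  v_ac : ∀ t ∈ J, AbsolutelyContinuousOnInterval v t0 t
  a_ac : ∀ t ∈ J, AbsolutelyContinuousOnInterval a t0 t
  w_deriv : ∀ t ∈ J, HasDerivWithinAt w (D.χw (D.A *ᵥ q t) (w t)) J t
  dynamics : ∀ᵐ t ∂(volume.restrict J), ∃ acc : Vec n, HasDerivAt v acc t ∧
    S.M (q t) (σ t) t *ᵥ acc + S.C (q t) (v t) (σ t) t *ᵥ v t + S.g (q t) (σ t) t
      = S.B (q t) (σ t) t *ᵥ D.τ (a t) (q t) (v t) (w t) t
  adaptation : ∀ᵐ t ∂(volume.restrict J),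
    HasDerivAt a (D.adaptRhs (a t) (q t) (v t) (w t) t) t
  a_init_pos : ∀ i, 0 < a t0 i

namespace Trajectory

variable {D S} (x : Trajectory D S)

/-- The controlled coordinates `ζ(t) = A q(t)`. -/
def ζ (t : ℝ) : Vec m := D.A *ᵥ x.q t

/-- The path-following error `dist(ζ(t), 𝒫)`. -/
def pathError (t : ℝ) : ℝ := distTo (x.ζ t) D.path

/-- The lifted path-following error `dist(ξ(t), 𝒫ʰᵍʰ)`, `ξ = (ζ, w)`. -/
def liftedPathError (t : ℝ) : ℝ := distTo (DesiredPath.ext (x.ζ t) (x.w t)) D.pathHgh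

/-- The adaptive error `‖a(t) - α‖`. -/
def adaptiveError (α : Vec k) (t : ℝ) : ℝ := nrm (x.a t - α)

/-- The norm of the combined error vector `(β, a - α) ∈ ℝ^{m+k}`. -/
def combinedError (α : Vec k) (t : ℝ) : ℝ :=
  nrm (Sum.elim (D.β (x.q t) (x.v t) (x.w t)) (x.a t - α))

/-- The size of the initial errors. -/
def initialError (α : Vec k) : ℝ := max (x.combinedError α x.t0) (x.liftedPathError x.t0)

end Trajectory

/-- Uniform ultimate boundedness of an error signal: there is an ultimate bound `bd` such that from
initial errors of size at most `r`, for any `r`, the signal is at most `bd` after a time `T` that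
depends on `r` but not on the initial time, the uncertainty signal or the trajectory. -/
def UniformlyUltimatelyBounded (α : Vec k) (err : Trajectory D S → ℝ → ℝ) : Prop :=
  ∃ bd : ℝ, 0 < bd ∧ ∀ r : ℝ, 0 < r → ∃ T : ℝ, 0 ≤ T ∧
    ∀ x : Trajectory D S, x.initialError α ≤ r →
      ∀ t ∈ x.J, x.t0 + T ≤ t → err x t ≤ bd

/-- The constant `K₁` of the decay estimate. -/
def K1 (lam ρ : ℝ) : ℝ := min (2 * D.κ * lam * (1 + ρ)) (2 * (1 + ρ) * D.l1⁻¹ * D.l2)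

/-- The constant `K₂` of the decay estimate. -/
def K2 (ρ : ℝ) (α : Vec k) : ℝ := 2 * (1 + ρ) * D.l1⁻¹ * D.l2 * nrm α

/-- The constant `K₃` of the decay estimate. -/
def K3 (ρ : ℝ) (α : Vec k) : ℝ := 1 / 2 * (1 + ρ) * (D.μ + D.ε * nrm α)

/-- The radius `R`, the positive root of `K₁ R² = K₂ R + K₃`. -/
def R (lam ρ : ℝ) (α : Vec k) : ℝ :=
  (D.K2 ρ α + Real.sqrt (D.K2 ρ α ^ 2 + 4 * D.K1 lam ρ * D.K3 ρ α)) / (2 * D.K1 lam ρ)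

/-- The lower coefficient `X₁`. -/
def X1 (ρ : ℝ) : ℝ := min (lamMin D.P) (D.l1⁻¹ * (1 + ρ))

/-- The upper coefficient `X₂`. -/
def X2 (ρ : ℝ) : ℝ := max (lamMax D.P) (D.l1⁻¹ * (1 + ρ))

/-- The time to reach the ball of radius `d` from the ball of radius `s`. -/
def reachTime (lam ρ : ℝ) (α : Vec k) (d s : ℝ) : ℝ :=
  if s ≤ d * Real.sqrt (D.X1 ρ / D.X2 ρ) then 0
  else (D.X2 ρ * s ^ 2 - D.X1 ρ ^ 2 / D.X2 ρ * d ^ 2) /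
    (D.K1 lam ρ * d ^ 2 * (D.X1 ρ / D.X2 ρ)
      - D.K2 ρ α * d * Real.sqrt (D.X1 ρ / D.X2 ρ) - D.K3 ρ α)

end Design

end PathFollowing

end

/-!
The proof combines two Lyapunov functions with a comparison argument for absolutely continuous
functions.

* The constraint-following error satisfies `β' = G ((1 + W) (p2 + p3) + residual)` almost everywhere
  (`β_rate`). The gain bound makes `G` invertible, which is what lets every matched part be
  multiplied back by `G`; the residual is dominated by `(1 + ρ) Π(α)`. With `β̆ = Gᵀ P β`, both `p2`
  and `p3` are nonpositive multiples of `β̆`, so that `1 + W ≥ 1 + ρ` turns them into dissipation.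
  For `V = βᵀ P β + (1 + ρ) l1⁻¹ ‖a - α‖²` the adaptive law cancels the difference between `Π(a)`
  and `Π(α)`; smoothing the control costs `μ / 4` (`robust_action_ge`), smoothing the adaptive law
  costs `ε ‖α‖ / 4` (`adaptation_le`, which uses `a ≥ 0`), and the leakage term completes
  `V' ≤ -(K1 N² - K2 N - K3)` with `N = ‖(β, a - α)‖` (`lyapunov_rate_le`).
* Since `X1 N² ≤ V ≤ X2 N²` and the rate is positive beyond its root `R`, sublevel sets of `V` that
  contain the ball of radius `R` are invariant, and `V` decreases at a definite speed outside of any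
  larger ball (`combinedError_le`, `combinedError_le_of_reachTime`). Solutions are only
  absolutely continuous, so monotonicity is deduced from the fundamental theorem of calculus for
  absolutely continuous functions (`sub_le_of_ae_deriv_le`).
* For the path-following error, `U = ½ ∑ k_i φ_i²` satisfies `U' ≤ ½ ‖β‖² - c U` with `c = min k_i`
  (`pathEnergy_rate_le`), hence decays exponentially to a level determined by the ultimate bound of
  `β` (`pathEnergy_decay`). The distance from `ζ` to the path is at most `‖φ‖`, and `‖φ‖` is at most
  a constant times the distance to the lifted path because the `f_i` have bounded derivatives
  (`exists_nrm_φ_le`); this makes all times depend on the size of the initial errors only.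
-/

namespace PathFollowing

/-! ### Euclidean norms and quadratic forms -/

section Norm

variable {ι κ : Type} [Fintype ι] [Fintype κ]

lemma nrm_nonneg (v : ι → ℝ) : 0 ≤ nrm v := norm_nonneg _

lemma nrm_sq (v : ι → ℝ) : nrm v ^ 2 = v ⬝ᵥ v := by
  rw [nrm, EuclideanSpace.norm_sq_eq]
  simp [dotProduct, sq]

lemma dotProduct_le_nrm_mul_nrm (u v : ι → ℝ) : u ⬝ᵥ v ≤ nrm u * nrm v := by
  have h := real_inner_le_norm (WithLp.toLp 2 u : EuclideanSpace ℝ ι) (WithLp.toLp 2 v)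
  rw [EuclideanSpace.inner_toLp_toLp, dotProduct_comm] at h
  simpa [nrm] using h

lemma nrm_smul (c : ℝ) (v : ι → ℝ) : nrm (c • v) = |c| * nrm v := by
  simp [nrm, norm_smul]

lemma abs_le_nrm (v : ι → ℝ) (i : ι) : |v i| ≤ nrm v := by
  simpa [nrm] using PiLp.norm_apply_le (WithLp.toLp 2 v : EuclideanSpace ℝ ι) i

lemma nrm_le_sum_abs (v : ι → ℝ) : nrm v ≤ ∑ i, |v i| := by
  refine abs_le_of_sq_le_sq' ?_ (Finset.sum_nonneg fun i _ => abs_nonneg _) |>.2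
  rw [nrm_sq, sq, Finset.sum_mul_sum, dotProduct]
  refine Finset.sum_le_sum fun i _ => ?_
  rw [← abs_mul_abs_self (v i)]
  exact Finset.single_le_sum (f := fun j => |v i| * |v j|) (fun j _ => by positivity)
    (Finset.mem_univ i)

lemma nrm_sum_elim_sq (u : ι → ℝ) (v : κ → ℝ) :
    nrm (Sum.elim u v) ^ 2 = nrm u ^ 2 + nrm v ^ 2 := by
  simp [nrm_sq, dotProduct]

lemma nrm_left_le (u : ι → ℝ) (v : κ → ℝ) : nrm u ≤ nrm (Sum.elim u v) :=
  abs_le_of_sq_le_sq' (by rw [nrm_sum_elim_sq]; nlinarith [sq_nonneg (nrm v)]) (nrm_nonneg _) |>.2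

lemma nrm_right_le (u : ι → ℝ) (v : κ → ℝ) : nrm v ≤ nrm (Sum.elim u v) :=
  abs_le_of_sq_le_sq' (by rw [nrm_sum_elim_sq]; nlinarith [sq_nonneg (nrm u)]) (nrm_nonneg _) |>.2

lemma distTo_le {x y : ι → ℝ} {s : Set (ι → ℝ)} (hy : y ∈ s) : distTo x s ≤ nrm (x - y) :=
  csInf_le ⟨0, by rintro _ ⟨z, _, rfl⟩; exact nrm_nonneg _⟩ ⟨y, hy, rfl⟩

end Norm

section Spectrum

variable {m : ℕ} {S : Matrix (Fin m) (Fin m) ℝ}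

lemma spectrum_finite (S : Matrix (Fin m) (Fin m) ℝ) : (spectrum ℝ S).Finite :=
  Matrix.finite_real_spectrum

lemma spectrum_nonempty (hm : 0 < m) (hS : S.IsHermitian) : (spectrum ℝ S).Nonempty :=
  ⟨_, hS.eigenvalues_mem_spectrum_real ⟨0, hm⟩⟩

lemma mul_dotProduct_le_of_le_spectrum (hS : S.IsHermitian) {c : ℝ}
    (hc : ∀ z ∈ spectrum ℝ S, c ≤ z) (x : Vec m) : c * (x ⬝ᵥ x) ≤ x ⬝ᵥ S *ᵥ x := by
  have hT : (S - algebraMap ℝ _ c).IsHermitian := by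
    refine hS.sub ?_
    rw [algebraMap_eq_diagonal]
    exact isHermitian_diagonal _
  have hp : (S - algebraMap ℝ _ c).PosSemidef := by
    rw [hT.posSemidef_iff_eigenvalues_nonneg]
    intro i
    have h := hT.eigenvalues_mem_spectrum_real i
    have h2 : hT.eigenvalues i + c ∈ spectrum ℝ S := by
      rw [spectrum.mem_iff] at h ⊢
      rwa [map_add, add_sub_assoc, ← neg_sub S, ← sub_eq_add_neg]
    have := hc _ h2
    simp only [Pi.zero_apply]
    linarith
  have h := hp.dotProduct_mulVec_nonneg x
  rw [sub_mulVec, dotProduct_sub, Algebra.algebraMap_eq_smul_one, smul_mulVec, one_mulVec,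
    dotProduct_smul, star_trivial, smul_eq_mul] at h
  linarith

lemma lamMin_mul_le (hS : S.IsHermitian) (x : Vec m) : lamMin S * (x ⬝ᵥ x) ≤ x ⬝ᵥ S *ᵥ x :=
  mul_dotProduct_le_of_le_spectrum hS
    (fun _ hz => csInf_le (spectrum_finite S).bddBelow hz) x

lemma le_lamMax_mul (hS : S.IsHermitian) (x : Vec m) : x ⬝ᵥ S *ᵥ x ≤ lamMax S * (x ⬝ᵥ x) := by
  have h := mul_dotProduct_le_of_le_spectrum hS.neg (c := -lamMax S) (fun z hz => by
    rw [← spectrum.neg_eq, Set.mem_neg] at hz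
    have := le_csSup (spectrum_finite S).bddAbove hz
    unfold lamMax
    linarith) x
  rw [neg_mulVec, dotProduct_neg] at h
  linarith

lemma lamMin_pos (hm : 0 < m) (hS : S.PosDef) : 0 < lamMin S := by
  have h := (spectrum_nonempty hm hS.1).csInf_mem (spectrum_finite S)
  rw [hS.1.spectrum_real_eq_range_eigenvalues] at h
  obtain ⟨i, hi⟩ := h
  rw [lamMin, hS.1.spectrum_real_eq_range_eigenvalues, ← hi]
  exact hS.eigenvalues_pos i

end Spectrum

/-! ### Absolute continuity and differential inequalities -/

section AbsCont

variable {a b : ℝ} {ι : Type} [Fintype ι]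

lemma absolutelyContinuous_apply {f : ℝ → ι → ℝ} (hf : AbsolutelyContinuousOnInterval f a b)
    (i : ι) : AbsolutelyContinuousOnInterval (fun t => f t i) a b :=
  squeeze_zero (fun _ => Finset.sum_nonneg fun _ _ => dist_nonneg)
    (fun _ => Finset.sum_le_sum fun _ _ => dist_le_pi_dist _ _ i) hf

lemma absolutelyContinuous_const (c : ℝ) :
    AbsolutelyContinuousOnInterval (fun _ => c) a b := by
  have : LipschitzOnWith 0 (fun _ : ℝ => c) (Set.uIcc a b) :=
    (LipschitzWith.const c).lipschitzOnWith
  exact this.absolutelyContinuousOnInterval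

lemma absolutelyContinuous_sum {κ : Type} (s : Finset κ) {f : κ → ℝ → ℝ}
    (hf : ∀ i, AbsolutelyContinuousOnInterval (f i) a b) :
    AbsolutelyContinuousOnInterval (fun t => ∑ i ∈ s, f i t) a b := by
  classical
  induction s using Finset.induction_on with
  | empty => simpa using absolutelyContinuous_const 0
  | insert i s hi ih => simpa [Finset.sum_insert hi] using (hf i).fun_add ih

lemma absolutelyContinuous_dotProduct {u v : ℝ → ι → ℝ}
    (hu : ∀ i, AbsolutelyContinuousOnInterval (fun t => u t i) a b)
    (hv : ∀ i, AbsolutelyContinuousOnInterval (fun t => v t i) a b) :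
    AbsolutelyContinuousOnInterval (fun t => u t ⬝ᵥ v t) a b :=
  absolutelyContinuous_sum _ fun i => (hu i).fun_mul (hv i)

lemma absolutelyContinuous_mulVec {κ : Type} {v : ℝ → ι → ℝ} (A : Matrix κ ι ℝ)
    (hv : ∀ i, AbsolutelyContinuousOnInterval (fun t => v t i) a b) (j : κ) :
    AbsolutelyContinuousOnInterval (fun t => (A *ᵥ v t) j) a b :=
  absolutelyContinuous_sum _ fun i => (hv i).const_mul (A j i)

/-- A function with a continuous derivative on a compact interval is absolutely continuous. -/
lemma absolutelyContinuous_of_hasDerivWithinAt {f f' : ℝ → ℝ} (hab : a ≤ b)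
    (hf : ∀ t ∈ Set.Icc a b, HasDerivWithinAt f (f' t) (Set.Icc a b) t)
    (hf' : ContinuousOn f' (Set.Icc a b)) : AbsolutelyContinuousOnInterval f a b := by
  obtain ⟨C, hC⟩ := isCompact_Icc.exists_bound_of_continuousOn hf'
  have h : LipschitzOnWith (Real.toNNReal C) f (Set.uIcc a b) := by
    rw [Set.uIcc_of_le hab]
    refine (convex_Icc a b).lipschitzOnWith_of_nnnorm_hasDerivWithin_le hf fun t ht => ?_
    rw [← NNReal.coe_le_coe, coe_nnnorm]
    exact (hC t ht).trans (Real.le_coe_toNNReal C)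
  exact h.absolutelyContinuousOnInterval

/-- An absolutely continuous function whose derivative is almost everywhere at most `c` grows at
most linearly with slope `c`. -/
lemma sub_le_of_ae_deriv_le {f : ℝ → ℝ} (hab : a ≤ b)
    (hf : AbsolutelyContinuousOnInterval f a b) {c : ℝ}
    (hd : ∀ᵐ t, t ∈ Set.Ioo a b → ∃ f', HasDerivAt f f' t ∧ f' ≤ c) :
    f b - f a ≤ c * (b - a) := by
  rw [← hf.integral_deriv_eq_sub]
  have h : ∫ t in a..b, deriv f t ≤ ∫ _ in a..b, c := by
    refine intervalIntegral.integral_mono_ae_restrict hab hf.intervalIntegrable_deriv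
      intervalIntegrable_const ?_
    rw [← restrict_Ioo_eq_restrict_Icc]
    refine (ae_restrict_iff' measurableSet_Ioo).2 ?_
    filter_upwards [hd] with t ht hmem
    obtain ⟨f', h1, h2⟩ := ht hmem
    rwa [h1.deriv]
  rw [intervalIntegral.integral_const, smul_eq_mul] at h
  linarith

lemma hasDerivAt_dotProduct {u v : ℝ → ι → ℝ} {u' v' : ι → ℝ} {t : ℝ}
    (hu : HasDerivAt u u' t) (hv : HasDerivAt v v' t) :
    HasDerivAt (fun s => u s ⬝ᵥ v s) (u' ⬝ᵥ v t + u t ⬝ᵥ v') t := by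
  rw [hasDerivAt_pi] at hu hv
  simp only [dotProduct, ← Finset.sum_add_distrib]
  exact HasDerivAt.fun_sum fun i _ => (hu i).mul (hv i)

lemma hasDerivWithinAt_mulVec {κ : Type} [Fintype κ] {v : ℝ → ι → ℝ} {v' : ι → ℝ} {t : ℝ}
    {s : Set ℝ} (A : Matrix κ ι ℝ) (hv : HasDerivWithinAt v v' s t) :
    HasDerivWithinAt (fun r => A *ᵥ v r) (A *ᵥ v') s t :=
  (LinearMap.toContinuousLinearMap A.mulVecLin).hasFDerivAt.comp_hasDerivWithinAt t hv

lemma hasDerivAt_mulVec {κ : Type} [Fintype κ] {v : ℝ → ι → ℝ} {v' : ι → ℝ} {t : ℝ}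
    (A : Matrix κ ι ℝ) (hv : HasDerivAt v v' t) :
    HasDerivAt (fun r => A *ᵥ v r) (A *ᵥ v') t :=
  (LinearMap.toContinuousLinearMap A.mulVecLin).hasFDerivAt.comp_hasDerivAt t hv

/-- If `V' ≤ 0` almost everywhere above the level `c`, an absolutely continuous `V` that starts
below this level stays below it. -/
lemma le_of_deriv_nonpos_above {V : ℝ → ℝ} {c : ℝ} (hab : a ≤ b)
    (hV : AbsolutelyContinuousOnInterval V a b) (ha : V a ≤ c)
    (hd : ∀ᵐ t, t ∈ Set.Ioo a b → c < V t → ∃ V', HasDerivAt V V' t ∧ V' ≤ 0) : V b ≤ c := by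
  by_contra! hb
  have hcont : ContinuousOn V (Set.Icc a b) := by
    simpa [Set.uIcc_of_le hab] using hV.continuousOn
  -- the last time at which `V ≤ c`
  have hclosed : IsClosed (Set.Icc a b ∩ V ⁻¹' Set.Iic c) :=
    hcont.preimage_isClosed_of_isClosed isClosed_Icc isClosed_Iic
  have hcomp : IsCompact (Set.Icc a b ∩ V ⁻¹' Set.Iic c) :=
    isCompact_Icc.of_isClosed_subset hclosed Set.inter_subset_left
  obtain ⟨s, ⟨hs, hsc⟩, hmax⟩ := hcomp.exists_isGreatest ⟨a, ⟨le_rfl, hab⟩, ha⟩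
  have hV' : AbsolutelyContinuousOnInterval V s b := hV.mono (by
    rw [Set.uIcc_of_le hab, Set.uIcc_of_le hs.2]
    exact Set.Icc_subset_Icc hs.1 le_rfl)
  have h := sub_le_of_ae_deriv_le (c := 0) hs.2 hV' (by
    filter_upwards [hd] with t ht hmem
    refine ht ⟨hs.1.trans_lt hmem.1, hmem.2⟩ ?_
    by_contra! hle
    exact absurd (hmax ⟨⟨hs.1.trans hmem.1.le, hmem.2.le⟩, hle⟩) (not_le.2 hmem.1))
  simp only [Set.mem_preimage, Set.mem_Iic] at hsc
  linarith

end AbsCont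

namespace Design

variable {n m p k : ℕ} {S : UncertainSystem n m p} {D : Design n m k} {lam ρ : ℝ} {α : Vec k}

/-! ### The closed-loop dynamics of the constraint-following error -/

lemma Mbar_inv_transpose (D : Design n m k) (q : Vec n) {t : ℝ} (ht : 0 ≤ t) :
    ((D.Mbar q t)⁻¹)ᵀ = (D.Mbar q t)⁻¹ := by
  have h := (D.Mbar_posDef q t ht).1
  rw [Matrix.IsHermitian, conjTranspose_eq_transpose_of_trivial] at h
  rw [transpose_nonsing_inv, h]

lemma P_transpose (D : Design n m k) : D.Pᵀ = D.P := by
  have h := D.P_posDef.1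
  rwa [Matrix.IsHermitian, conjTranspose_eq_transpose_of_trivial] at h

lemma βbreve_eq (D : Design n m k) (q v : Vec n) (w : ℝ) {t : ℝ} (ht : 0 ≤ t) :
    D.βbreve q v w t = ((D.G q t)ᵀ * D.P) *ᵥ D.β q v w := by
  simp only [βbreve, G, transpose_mul, D.Mbar_inv_transpose q ht, Matrix.mul_assoc]

lemma le_dotProduct_gain (hgain : D.NominalGainBound lam) (q : Vec n) {t : ℝ} (ht : 0 ≤ t)
    (x : Vec m) :
    lam * (x ⬝ᵥ x) ≤ (((D.G q t)ᵀ * D.P) *ᵥ x) ⬝ᵥ (((D.G q t)ᵀ * D.P) *ᵥ x) := by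
  have hT : D.P * D.G q t * (D.G q t)ᵀ * D.P = ((D.G q t)ᵀ * D.P)ᵀ * ((D.G q t)ᵀ * D.P) := by
    rw [transpose_mul, transpose_transpose, P_transpose, Matrix.mul_assoc]
  have hH : (D.P * D.G q t * (D.G q t)ᵀ * D.P).IsHermitian := by
    rw [hT, ← conjTranspose_eq_transpose_of_trivial]
    exact isHermitian_conjTranspose_mul_self _
  have h := lamMin_mul_le hH x
  have h0 : 0 ≤ x ⬝ᵥ x := by rw [← nrm_sq]; positivity
  refine (mul_le_mul_of_nonneg_right (hgain q t ht) h0).trans (h.trans_eq ?_)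
  rw [hT, ← mulVec_mulVec, dotProduct_mulVec, vecMul_transpose]

/-- The uniform lower bound on `P G Gᵀ P` makes `G` invertible, so that its inverse in the control
law is a genuine one. -/
lemma isUnit_det_G (hlam : 0 < lam) (hgain : D.NominalGainBound lam) (q : Vec n) {t : ℝ}
    (ht : 0 ≤ t) : IsUnit (D.G q t).det := by
  rw [isUnit_iff_ne_zero]
  intro h0
  have hd : ((D.G q t)ᵀ * D.P).det = 0 := by rw [det_mul, det_transpose, h0, zero_mul]
  obtain ⟨x, hx, hx0⟩ := exists_mulVec_eq_zero_iff.2 hd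
  have h := le_dotProduct_gain hgain q ht x
  rw [hx0, dotProduct_zero] at h
  have hx2 : 0 < x ⬝ᵥ x := by
    rw [← dotProduct_star_self_pos_iff] at hx
    simpa using hx
  nlinarith

lemma lam_mul_le_βbreve (hgain : D.NominalGainBound lam) (q v : Vec n) (w : ℝ) {t : ℝ}
    (ht : 0 ≤ t) : lam * nrm (D.β q v w) ^ 2 ≤ nrm (D.βbreve q v w t) ^ 2 := by
  rw [nrm_sq, nrm_sq, βbreve_eq D q v w ht]
  exact le_dotProduct_gain hgain q ht _

/-- The part of the matched uncertainty that the feedforward control `p1` does not compensate. -/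
noncomputable def residual (D : Design n m k) (S : UncertainSystem n m p) (q v : Vec n) (w : ℝ) (σ : Vec p)
    (t : ℝ) : Vec m :=
  D.Hchk S q σ t *ᵥ (-(S.C q v σ t *ᵥ v) - S.g q σ t + S.B q σ t *ᵥ D.p1 q v w t)
    + (D.Bchk S q σ t *ᵥ D.p1 q v w t - D.Cchk S q v σ t *ᵥ v - D.gchk S q σ t)

/-- The error dynamics `β' = G ((1 + W) (p2 + p3) + residual)`: multiplication by `G` turns
matched parts back into the corresponding accelerations of the controlled coordinates. -/
lemma β_rate (hlam : 0 < lam) (hgain : D.NominalGainBound lam) {q v acc : Vec n} {w t : ℝ}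
    {σ : Vec p} {a : Vec k} (ht : 0 ≤ t) (hσ : σ ∈ S.unc)
    (hdyn : S.M q σ t *ᵥ acc + S.C q v σ t *ᵥ v + S.g q σ t = S.B q σ t *ᵥ D.τ a q v w t) :
    D.A *ᵥ acc - D.b q v w = D.G q t *ᵥ
      ((D.p2 q v w t + D.p3 a q v w t) + D.W S q σ t *ᵥ (D.p2 q v w t + D.p3 a q v w t)
        + D.residual S q v w σ t) := by
  have hG := isUnit_det_G hlam hgain q ht
  have hM : IsUnit (S.M q σ t).det := (isUnit_iff_isUnit_det _).1 (S.M_posDef q σ hσ t ht).isUnit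
  have hMb : IsUnit (D.Mbar q t).det := (isUnit_iff_isUnit_det _).1 (D.Mbar_posDef q t ht).isUnit
  obtain ⟨N, hN⟩ : ∃ N, N = D.A * (D.Mbar q t)⁻¹ := ⟨_, rfl⟩
  have hNG : ∀ x, D.G q t *ᵥ x = N *ᵥ (D.Bbar q t *ᵥ x) := fun x => by
    rw [hN, mulVec_mulVec, G]
  have hmat : ∀ x, D.G q t *ᵥ (D.matched q t *ᵥ x) = N *ᵥ x := fun x => by
    rw [matched, mulVec_mulVec, mul_nonsing_inv_cancel_left _ _ hG, hN]
  have hp1 : D.G q t *ᵥ D.p1 q v w t = D.b q v w + N *ᵥ (D.Cbar q v t *ᵥ v + D.gbar q t) := by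
    rw [p1, mulVec_mulVec, mul_nonsing_inv _ hG, one_mulVec, hN]
  have hNM : D.A *ᵥ acc = N *ᵥ (S.M q σ t *ᵥ acc + D.H S q σ t *ᵥ (S.M q σ t *ᵥ acc)) := by
    have h1 : (D.Mbar q t * (S.M q σ t)⁻¹) *ᵥ (S.M q σ t *ᵥ acc) = D.Mbar q t *ᵥ acc := by
      rw [mulVec_mulVec, Matrix.mul_assoc, nonsing_inv_mul _ hM, Matrix.mul_one]
    rw [H, sub_mulVec, one_mulVec, add_sub_cancel, h1, mulVec_mulVec, hN, Matrix.mul_assoc,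
      nonsing_inv_mul _ hMb, Matrix.mul_one]
  have hF : S.M q σ t *ᵥ acc = S.B q σ t *ᵥ D.τ a q v w t - S.C q v σ t *ᵥ v - S.g q σ t := by
    rw [← hdyn]; abel
  rw [hNM, hF]
  have hτ : D.τ a q v w t = D.p1 q v w t + (D.p2 q v w t + D.p3 a q v w t) := by
    rw [τ, add_assoc]
  rw [hτ]
  generalize D.p2 q v w t + D.p3 a q v w t = u
  have hb : D.b q v w = N *ᵥ (D.Bbar q t *ᵥ D.p1 q v w t)
      - N *ᵥ (D.Cbar q v t *ᵥ v + D.gbar q t) := by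
    rw [← hNG, hp1]; abel
  rw [hb]
  simp only [residual, W, Hchk, Bchk, Cchk, gchk, mulVec_add, add_mulVec, ← mulVec_mulVec, hmat,
    mulVec_sub, sub_mulVec, mulVec_neg, hNG u]
  abel

lemma le_dotProduct_W (hW : D.InputUncertaintyBound S ρ) (q : Vec n) {σ : Vec p} {t : ℝ}
    (ht : 0 ≤ t) (hσ : σ ∈ S.unc) (x : Vec m) : ρ * (x ⬝ᵥ x) ≤ x ⬝ᵥ D.W S q σ t *ᵥ x := by
  have hH : (D.W S q σ t + (D.W S q σ t)ᵀ).IsHermitian := by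
    rw [Matrix.IsHermitian, conjTranspose_eq_transpose_of_trivial, transpose_add,
      transpose_transpose, add_comm]
  have h := lamMin_mul_le hH x
  rw [add_mulVec, dotProduct_add, mulVec_transpose, dotProduct_comm x (_ ᵥ* _),
    ← dotProduct_mulVec] at h
  have h0 : 0 ≤ x ⬝ᵥ x := by rw [← nrm_sq]; positivity
  nlinarith [mul_le_mul_of_nonneg_right (hW q t ht σ hσ) h0]

lemma nrm_residual_le (hρ : -1 < ρ) (henv : D.EnvelopeBound S ρ α) (q v : Vec n) (w : ℝ)
    {σ : Vec p} {t : ℝ} (ht : 0 ≤ t) (hσ : σ ∈ S.unc) :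
    nrm (D.residual S q v w σ t) ≤ (1 + ρ) * D.Env α q v w t := by
  have h := henv q v w t ht σ hσ
  rwa [inv_mul_le_iff₀ (by linarith)] at h

/-! ### Decay of the Lyapunov function -/

lemma η_nonneg (D : Design n m k) (a : Vec k) (q v : Vec n) (w t : ℝ) :
    0 ≤ D.η a q v w t := by
  unfold η
  split_ifs
  · exact div_nonneg zero_le_one (nrm_nonneg _)
  · exact div_nonneg zero_le_one D.μ_pos.le

/-- The smoothed unit vector `η υ` loses at most `μ / 4` against the discontinuous one. -/
lemma robust_action_ge (D : Design n m k) (a : Vec k) (q v : Vec n) (w t : ℝ) :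
    D.Env a q v w t * nrm (D.βbreve q v w t) - D.μ / 4
      ≤ D.η a q v w t * D.Env a q v w t ^ 2 * nrm (D.βbreve q v w t) ^ 2 := by
  have hυ : nrm (D.υ a q v w t) = |D.Env a q v w t| * nrm (D.βbreve q v w t) := nrm_smul _ _
  have hz := nrm_nonneg (D.βbreve q v w t)
  have hμ := D.μ_pos
  have h1 : D.Env a q v w t * nrm (D.βbreve q v w t) ≤ nrm (D.υ a q v w t) := by
    rw [hυ]; exact mul_le_mul_of_nonneg_right (le_abs_self _) hz
  have h2 : D.η a q v w t * D.Env a q v w t ^ 2 * nrm (D.βbreve q v w t) ^ 2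
      = D.η a q v w t * nrm (D.υ a q v w t) ^ 2 := by
    rw [hυ, mul_pow, sq_abs, mul_assoc]
  rw [h2]
  refine (sub_le_sub_right h1 _).trans ?_
  generalize hy : nrm (D.υ a q v w t) = y
  unfold η
  rw [hy]
  split_ifs with h
  · have : y ≠ 0 := by linarith
    have : 1 / y * y ^ 2 = y := by field_simp
    linarith
  · rw [one_div_mul_eq_div, le_div_iff₀ hμ]
    nlinarith [sq_nonneg (y - D.μ / 2)]

/-- The adaptive law cancels the mismatch between the estimated and the true envelope, up to
`ε ‖α‖ / 4` and the leakage terms. In the branch below the threshold `ε`, only the part of the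
mismatch that comes from `α` costs anything, because `0 ≤ a`. -/
lemma adaptation_le (D : Design n m k) {a : Vec k} (ha : ∀ i, 0 ≤ a i)
    (q v : Vec n) (w t : ℝ) :
    D.l1⁻¹ * ((a - α) ⬝ᵥ D.adaptRhs a q v w t) ≤
      nrm (D.βbreve q v w t) * (D.Env a q v w t - D.Env α q v w t) + D.ε * nrm α / 4
        - D.l1⁻¹ * D.l2 * (nrm (a - α) ^ 2 - nrm α * nrm (a - α)) := by
  have hl1 := D.l1_pos
  have hl2 := D.l2_pos
  have hε := D.ε_pos
  have hz := nrm_nonneg (D.βbreve q v w t)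
  have hleak : nrm (a - α) ^ 2 - nrm α * nrm (a - α) ≤ (a - α) ⬝ᵥ a := by
    have h1 := dotProduct_le_nrm_mul_nrm (-α) (a - α)
    have h2 : nrm (-α) = nrm α := by simp [nrm]
    have h3 : (a - α) ⬝ᵥ a = (a - α) ⬝ᵥ (a - α) - (-α) ⬝ᵥ (a - α) := by
      rw [neg_dotProduct, sub_neg_eq_add, dotProduct_comm α, ← dotProduct_add, sub_add_cancel]
    rw [h3, nrm_sq]
    rw [h2] at h1
    linarith
  have hmis : (a - α) ⬝ᵥ D.env q v w t = D.Env a q v w t - D.Env α q v w t := by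
    rw [sub_dotProduct]; rfl
  have hEa : 0 ≤ D.Env a q v w t := by
    unfold Env dotProduct
    exact Finset.sum_nonneg fun i _ => mul_nonneg (ha i) (D.env_nonneg q v w t i)
  have hEα : D.Env α q v w t ≤ nrm α * nrm (D.env q v w t) := dotProduct_le_nrm_mul_nrm _ _
  have hp := nrm_nonneg (D.env q v w t)
  have hlk : D.l1⁻¹ * D.l2 * (nrm (a - α) ^ 2 - nrm α * nrm (a - α))
      ≤ D.l1⁻¹ * D.l2 * ((a - α) ⬝ᵥ a) := by gcongr
  unfold adaptRhs
  generalize nrm (D.βbreve q v w t) = z at *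
  generalize nrm (D.env q v w t) = r at *
  split_ifs with h
  · rw [dotProduct_sub, dotProduct_smul, dotProduct_smul, hmis, smul_eq_mul, smul_eq_mul]
    have h1 : D.l1⁻¹ * (D.l1 * z * (D.Env a q v w t - D.Env α q v w t) - D.l2 * ((a - α) ⬝ᵥ a))
        = z * (D.Env a q v w t - D.Env α q v w t) - D.l1⁻¹ * D.l2 * ((a - α) ⬝ᵥ a) := by
      field_simp
    rw [h1]
    have : 0 ≤ D.ε * nrm α / 4 := by have := nrm_nonneg α; positivity
    linarith
  · rw [dotProduct_sub, dotProduct_smul, dotProduct_smul, hmis, smul_eq_mul, smul_eq_mul]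
    have h1 : D.l1⁻¹ * (D.l1 * (r * z ^ 2 / D.ε) * (D.Env a q v w t - D.Env α q v w t)
          - D.l2 * ((a - α) ⬝ᵥ a))
        = r * z ^ 2 / D.ε * (D.Env a q v w t - D.Env α q v w t)
          - D.l1⁻¹ * D.l2 * ((a - α) ⬝ᵥ a) := by
      field_simp
    rw [h1]
    -- with `x = r z ≤ ε`, the defect is at most `‖α‖ x (1 - x / ε) ≤ ‖α‖ ε / 4`
    have h2 : 0 ≤ 1 - r * z / D.ε := by
      rw [sub_nonneg, div_le_one hε]; linarith
    have h3 : z * (1 - r * z / D.ε) * (D.Env α q v w t - D.Env a q v w t)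
        ≤ z * (1 - r * z / D.ε) * (nrm α * r) :=
      mul_le_mul_of_nonneg_left (by linarith) (mul_nonneg hz h2)
    have h4 : r * z * (1 - r * z / D.ε) ≤ D.ε / 4 := by
      have : D.ε / 4 - r * z * (1 - r * z / D.ε) = (r * z - D.ε / 2) ^ 2 / D.ε := by
        field_simp; ring
      have : 0 ≤ (r * z - D.ε / 2) ^ 2 / D.ε := by positivity
      linarith
    have h5 := mul_le_mul_of_nonneg_left h4 (nrm_nonneg α)
    have h6 : r * z ^ 2 / D.ε * (D.Env a q v w t - D.Env α q v w t)
        = z * (D.Env a q v w t - D.Env α q v w t)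
          + z * (1 - r * z / D.ε) * (D.Env α q v w t - D.Env a q v w t) := by
      field_simp; ring
    rw [h6]
    nlinarith

/-- The Lyapunov function `βᵀ P β + (1 + ρ) l1⁻¹ ‖a - α‖²` in terms of the error vectors. -/
noncomputable def lyapunov (D : Design n m k) (ρ : ℝ) (y : Vec m) (e : Vec k) : ℝ :=
  y ⬝ᵥ D.P *ᵥ y + D.l1⁻¹ * (1 + ρ) * (e ⬝ᵥ e)

lemma X1_pos (hm : 0 < m) (hρ : -1 < ρ) : 0 < D.X1 ρ :=
  lt_min (lamMin_pos hm D.P_posDef) (mul_pos (inv_pos.2 D.l1_pos) (by linarith))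

lemma X1_le_X2 (D : Design n m k) (ρ : ℝ) : D.X1 ρ ≤ D.X2 ρ :=
  (min_le_right _ _).trans (le_max_right _ _)

lemma X1_mul_le_lyapunov (D : Design n m k) (ρ : ℝ) (y : Vec m) (e : Vec k) :
    D.X1 ρ * nrm (Sum.elim y e) ^ 2 ≤ D.lyapunov ρ y e := by
  rw [nrm_sum_elim_sq, lyapunov, ← nrm_sq e]
  have h1 := lamMin_mul_le D.P_posDef.1 y
  rw [← nrm_sq] at h1
  have h2 : D.X1 ρ ≤ lamMin D.P := min_le_left _ _
  have h3 : D.X1 ρ ≤ D.l1⁻¹ * (1 + ρ) := min_le_right _ _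
  linarith [mul_le_mul_of_nonneg_right h2 (sq_nonneg (nrm y)),
    mul_le_mul_of_nonneg_right h3 (sq_nonneg (nrm e))]

lemma lyapunov_le_X2_mul (D : Design n m k) (ρ : ℝ) (y : Vec m) (e : Vec k) :
    D.lyapunov ρ y e ≤ D.X2 ρ * nrm (Sum.elim y e) ^ 2 := by
  rw [nrm_sum_elim_sq, lyapunov, ← nrm_sq e]
  have h1 := le_lamMax_mul D.P_posDef.1 y
  rw [← nrm_sq] at h1
  have h2 : lamMax D.P ≤ D.X2 ρ := le_max_left _ _
  have h3 : D.l1⁻¹ * (1 + ρ) ≤ D.X2 ρ := le_max_right _ _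
  linarith [mul_le_mul_of_nonneg_right h2 (sq_nonneg (nrm y)),
    mul_le_mul_of_nonneg_right h3 (sq_nonneg (nrm e))]

/-- The derivative of the Lyapunov function along the closed loop, written in terms of the
right-hand sides of the differential equations for `β` and `a`. -/
lemma lyapunov_rate_le (hlam : 0 < lam) (hgain : D.NominalGainBound lam) (hρ : -1 < ρ)
    (hW : D.InputUncertaintyBound S ρ) (henv : D.EnvelopeBound S ρ α)
    {q v acc : Vec n} {w t : ℝ} {σ : Vec p} {a : Vec k} (ht : 0 ≤ t) (hσ : σ ∈ S.unc)
    (ha : ∀ i, 0 ≤ a i)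
    (hdyn : S.M q σ t *ᵥ acc + S.C q v σ t *ᵥ v + S.g q σ t = S.B q σ t *ᵥ D.τ a q v w t) :
    2 * (D.β q v w ⬝ᵥ D.P *ᵥ (D.A *ᵥ acc - D.b q v w))
        + D.l1⁻¹ * (1 + ρ) * (2 * ((a - α) ⬝ᵥ D.adaptRhs a q v w t))
      ≤ -(D.K1 lam ρ * nrm (Sum.elim (D.β q v w) (a - α)) ^ 2
          - D.K2 ρ α * nrm (Sum.elim (D.β q v w) (a - α)) - D.K3 ρ α) := by
  rw [β_rate hlam hgain ht hσ hdyn]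
  have hρ' : 0 < 1 + ρ := by linarith
  obtain ⟨c, hc⟩ : ∃ c, c = D.κ + D.η a q v w t * D.Env a q v w t ^ 2 := ⟨_, rfl⟩
  have hc0 : 0 ≤ c := by
    have := D.η_nonneg a q v w t
    have := D.κ_pos
    rw [hc]; positivity
  have hu : D.p2 q v w t + D.p3 a q v w t = -(c • D.βbreve q v w t) := by
    rw [p2, p3, υ, ← βbreve_eq D q v w ht, smul_smul, ← neg_add, ← add_smul, hc]
    congr 3; ring
  have hpair : ∀ r, D.β q v w ⬝ᵥ D.P *ᵥ (D.G q t *ᵥ r) = D.βbreve q v w t ⬝ᵥ r := fun r => by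
    rw [βbreve_eq D q v w ht, mulVec_mulVec, dotProduct_mulVec]
    congr 1
    rw [← mulVec_transpose, transpose_mul, P_transpose]
  rw [hpair, hu]
  have hdiss : D.βbreve q v w t ⬝ᵥ (-(c • D.βbreve q v w t)
        + D.W S q σ t *ᵥ -(c • D.βbreve q v w t) + D.residual S q v w σ t)
      ≤ (1 + ρ) * (-(c * nrm (D.βbreve q v w t) ^ 2)
        + nrm (D.βbreve q v w t) * D.Env α q v w t) := by
    rw [dotProduct_add, dotProduct_add, mulVec_neg, mulVec_smul, dotProduct_neg, dotProduct_neg,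
      dotProduct_smul, dotProduct_smul, smul_eq_mul, smul_eq_mul, ← nrm_sq]
    have h1 := le_dotProduct_W hW q ht hσ (D.βbreve q v w t)
    rw [← nrm_sq] at h1
    have h2 := dotProduct_le_nrm_mul_nrm (D.βbreve q v w t) (D.residual S q v w σ t)
    have h3 := mul_le_mul_of_nonneg_left (nrm_residual_le hρ henv q v w ht hσ)
      (nrm_nonneg (D.βbreve q v w t))
    nlinarith [mul_le_mul_of_nonneg_left h1 hc0]
  have hrob := D.robust_action_ge a q v w t
  have hada := D.adaptation_le (α := α) ha q v w t
  have hgn := lam_mul_le_βbreve hgain q v w ht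
  have hcz : c * nrm (D.βbreve q v w t) ^ 2 = D.κ * nrm (D.βbreve q v w t) ^ 2
      + D.η a q v w t * D.Env a q v w t ^ 2 * nrm (D.βbreve q v w t) ^ 2 := by rw [hc]; ring
  have hN := nrm_sum_elim_sq (D.β q v w) (a - α)
  have hNe := nrm_right_le (D.β q v w) (a - α)
  have hmain : D.βbreve q v w t ⬝ᵥ (-(c • D.βbreve q v w t)
        + D.W S q σ t *ᵥ -(c • D.βbreve q v w t) + D.residual S q v w σ t)
        + (1 + ρ) * (D.l1⁻¹ * ((a - α) ⬝ᵥ D.adaptRhs a q v w t))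
      ≤ (1 + ρ) * (-(D.κ * lam * nrm (D.β q v w) ^ 2) + (D.μ + D.ε * nrm α) / 4
        - D.l1⁻¹ * D.l2 * (nrm (a - α) ^ 2 - nrm α * nrm (a - α))) := by
    have h1 := mul_le_mul_of_nonneg_left hada hρ'.le
    have h2 := mul_le_mul_of_nonneg_left hgn D.κ_pos.le
    have h3 : (1 + ρ) * (-(c * nrm (D.βbreve q v w t) ^ 2)
          + nrm (D.βbreve q v w t) * D.Env α q v w t)
          ≤ (1 + ρ) * (-(D.κ * lam * nrm (D.β q v w) ^ 2)
            - D.Env a q v w t * nrm (D.βbreve q v w t) + D.μ / 4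
            + nrm (D.βbreve q v w t) * D.Env α q v w t) := by
      refine mul_le_mul_of_nonneg_left ?_ hρ'.le
      rw [hcz]; linarith
    nlinarith
  have hK1 : D.K1 lam ρ * nrm (Sum.elim (D.β q v w) (a - α)) ^ 2
      ≤ 2 * D.κ * lam * (1 + ρ) * nrm (D.β q v w) ^ 2
        + 2 * (1 + ρ) * D.l1⁻¹ * D.l2 * nrm (a - α) ^ 2 := by
    rw [hN, mul_add]
    exact add_le_add (mul_le_mul_of_nonneg_right (min_le_left _ _) (sq_nonneg _))
      (mul_le_mul_of_nonneg_right (min_le_right _ _) (sq_nonneg _))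
  have hK2 : 2 * (1 + ρ) * D.l1⁻¹ * D.l2 * nrm α * nrm (a - α)
      ≤ D.K2 ρ α * nrm (Sum.elim (D.β q v w) (a - α)) := by
    have := nrm_nonneg α
    have := D.l1_pos
    have := D.l2_pos
    exact mul_le_mul_of_nonneg_left hNe (by positivity)
  unfold K3
  linarith

/-! ### Regularity along trajectories -/

lemma hasDerivAt_f (D : Design n m k) (i : Fin m) (w : ℝ) :
    HasDerivAt (D.f i) (deriv (D.f i) w) w :=
  ((D.f_contDiff i).differentiable (by norm_num) w).hasDerivAt

lemma contDiff_deriv_f (D : Design n m k) (i : Fin m) : ContDiff ℝ 1 (deriv (D.f i)) := by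
  have h : ContDiff ℝ (1 + 1) (D.f i) := by
    rw [one_add_one_eq_two]; exact D.f_contDiff i
  exact (contDiff_succ_iff_deriv.1 h).2.2

lemma hasDerivAt_deriv_f (D : Design n m k) (i : Fin m) (w : ℝ) :
    HasDerivAt (deriv (D.f i)) (deriv (deriv (D.f i)) w) w :=
  ((D.contDiff_deriv_f i).differentiable (by norm_num) w).hasDerivAt

lemma χs_apply (D : Design n m k) (ζ : Vec m) (w : ℝ) (i : Fin m) :
    D.χs ζ w i = (-1) ^ m * deriv (D.f i) w - D.kf i * (ζ i - D.f i w) := rfl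

lemma b_apply (D : Design n m k) (q v : Vec n) (w : ℝ) (i : Fin m) :
    D.b q v w i = -(D.kf i * (D.A *ᵥ v) i) + D.χw (D.A *ᵥ q) w *
      ((-1) ^ m * deriv (deriv (D.f i)) w + D.kf i * deriv (D.f i) w) := by
  have h1 : HasFDerivAt (fun q' => D.χs (D.A *ᵥ q') w)
      (-(LinearMap.toContinuousLinearMap (diagonal D.kf * D.A).mulVecLin)) q := by
    have h := (LinearMap.toContinuousLinearMap (diagonal D.kf * D.A).mulVecLin).hasFDerivAt
      (x := q) |>.const_sub (fun i => (-1) ^ m * deriv (D.f i) w + D.kf i * D.f i w)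
    refine h.congr_of_eventuallyEq (Eventually.of_forall fun q' => ?_)
    funext j
    simp only [χs_apply, Pi.sub_apply, LinearMap.coe_toContinuousLinearMap', mulVecLin_apply,
      ← mulVec_mulVec, mulVec_diagonal]
    ring
  have h2 : HasDerivAt (fun w' => D.χs (D.A *ᵥ q) w')
      (fun i => (-1) ^ m * deriv (deriv (D.f i)) w + D.kf i * deriv (D.f i) w) w := by
    rw [hasDerivAt_pi]
    intro j
    simp only [χs_apply]
    exact (((D.hasDerivAt_deriv_f j w).const_mul ((-1) ^ m)).sub
      (((D.hasDerivAt_f j w).const_sub ((D.A *ᵥ q) j)).const_mul (D.kf j))).congr_deriv (by ring)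
  rw [b, h1.fderiv, h2.deriv]
  simp [mulVec_diagonal, -mulVec_mulVec]

/-- The vector `b` is the time derivative of `χs` along the closed loop. -/
lemma hasDerivWithinAt_χs (D : Design n m k) {q : ℝ → Vec n} {v : Vec n} {w : ℝ → ℝ} {t : ℝ}
    {s : Set ℝ} (hq : HasDerivWithinAt q v s t)
    (hw : HasDerivWithinAt w (D.χw (D.A *ᵥ q t) (w t)) s t) :
    HasDerivWithinAt (fun r => D.χs (D.A *ᵥ q r) (w r)) (D.b (q t) v (w t)) s t := by
  rw [hasDerivWithinAt_pi]
  intro i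
  simp only [χs_apply]
  have h1 := (hasDerivWithinAt_pi.1 (hasDerivWithinAt_mulVec D.A hq)) i
  have h2 := (D.hasDerivAt_deriv_f i (w t)).comp_hasDerivWithinAt t hw
  have h3 := (D.hasDerivAt_f i (w t)).comp_hasDerivWithinAt t hw
  have h4 := (h2.const_mul ((-1) ^ m)).sub ((h1.sub h3).const_mul (D.kf i))
  refine h4.congr_deriv ?_
  rw [b_apply]
  ring

lemma continuous_χw (D : Design n m k) : Continuous fun z : Vec m × ℝ => D.χw z.1 z.2 := by
  have h1 : ∀ i, Continuous (D.f i) := fun i => (D.f_contDiff i).continuous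
  have h2 : ∀ i, Continuous (deriv (D.f i)) := fun i => (D.contDiff_deriv_f i).continuous
  simp only [χw, DesiredPath.φ, DesiredPath.ext, Sum.elim_inl, Sum.elim_inr]
  fun_prop

lemma continuous_b (D : Design n m k) :
    Continuous fun z : Vec n × Vec n × ℝ => D.b z.1 z.2.1 z.2.2 := by
  refine continuous_pi fun i => ?_
  simp only [b_apply]
  have h1 : Continuous (D.f i) := (D.f_contDiff i).continuous
  have h2 : Continuous (deriv (D.f i)) := (D.contDiff_deriv_f i).continuous
  have h3 : Continuous (deriv (deriv (D.f i))) := (D.contDiff_deriv_f i).continuous_deriv le_rfl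
  have hA : ∀ {u : Vec n × Vec n × ℝ → Vec n}, Continuous u → Continuous fun z => D.A *ᵥ u z :=
    fun hu => continuous_const.matrix_mulVec hu
  have h4 : Continuous fun z : Vec n × Vec n × ℝ => D.χw (D.A *ᵥ z.1) z.2.2 :=
    D.continuous_χw.comp ((hA continuous_fst).prodMk continuous_snd.snd)
  have h5 := hA continuous_snd.fst
  fun_prop

namespace Trajectory

variable (x : Trajectory D S) {a b t : ℝ}

lemma Icc_subset (ha : a ∈ x.J) (hb : b ∈ x.J) : Set.Icc a b ⊆ x.J :=
  x.J_ordConnected.out ha hb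

lemma t0_le (ht : t ∈ x.J) : x.t0 ≤ t := x.J_subset ht

lemma nonneg_of_mem (ht : t ∈ x.J) : 0 ≤ t := x.t0_nonneg.trans (x.t0_le ht)

/-- Statements that hold almost everywhere on `J` hold at almost every point of an open interval
with end points in `J`, where derivatives within `J` are derivatives. -/
lemma ae_Ioo {Q : ℝ → Prop} (hQ : ∀ᵐ t ∂(volume.restrict x.J), Q t) (ha : a ∈ x.J)
    (hb : b ∈ x.J) : ∀ᵐ t, t ∈ Set.Ioo a b → t ∈ x.J ∧ x.J ∈ 𝓝 t ∧ Q t := by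
  filter_upwards [(ae_restrict_iff' x.J_ordConnected.measurableSet).1 hQ] with t ht hmem
  have hJ := x.Icc_subset ha hb (Set.Ioo_subset_Icc_self hmem)
  exact ⟨hJ, mem_of_superset (Icc_mem_nhds hmem.1 hmem.2) (x.Icc_subset ha hb), ht hJ⟩

lemma ac_mono {f : ℝ → ℝ} (hf : AbsolutelyContinuousOnInterval f x.t0 b) (ha : a ∈ x.J)
    (hb : b ∈ x.J) (hab : a ≤ b) : AbsolutelyContinuousOnInterval f a b := by
  refine hf.mono ?_
  rw [Set.uIcc_of_le hab, Set.uIcc_of_le (x.t0_le hb)]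
  exact Set.Icc_subset_Icc (x.t0_le ha) le_rfl

/-- The adaptive parameters stay nonnegative: `exp (l2 t) a_i(t)` is nondecreasing. -/
lemma a_nonneg (ht : t ∈ x.J) (i : Fin k) : 0 ≤ x.a t i := by
  have hexp : AbsolutelyContinuousOnInterval (fun s => -Real.exp (D.l2 * s)) x.t0 t :=
    ContDiffOn.absolutelyContinuousOnInterval (by fun_prop)
  have h := sub_le_of_ae_deriv_le (c := 0) (x.t0_le ht)
    (hexp.fun_mul (absolutelyContinuous_apply (x.a_ac t ht) i)) (by
      filter_upwards [x.ae_Ioo x.adaptation x.t0_mem ht] with s hs hmem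
      obtain ⟨-, -, hd⟩ := hs hmem
      have h1 : HasDerivAt (fun s => -Real.exp (D.l2 * s)) (-(Real.exp (D.l2 * s) * D.l2)) s := by
        simpa using (((hasDerivAt_id s).const_mul D.l2).exp).fun_neg
      refine ⟨_, h1.mul (hasDerivAt_pi.1 hd i), ?_⟩
      have h2 : 0 ≤ D.adaptRhs (x.a s) (x.q s) (x.v s) (x.w s) s i + D.l2 * x.a s i := by
        have := D.env_nonneg (x.q s) (x.v s) (x.w s) s i
        have := nrm_nonneg (D.βbreve (x.q s) (x.v s) (x.w s) s)
        have := nrm_nonneg (D.env (x.q s) (x.v s) (x.w s) s)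
        have := D.l1_pos
        have := D.ε_pos
        unfold adaptRhs
        split_ifs <;> simp only [Pi.sub_apply, Pi.smul_apply, smul_eq_mul, sub_add_cancel] <;>
          positivity
      nlinarith [mul_nonneg (Real.exp_pos (D.l2 * s)).le h2])
  have h3 := mul_pos (Real.exp_pos (D.l2 * x.t0)) (x.a_init_pos i)
  have h4 : 0 ≤ Real.exp (D.l2 * t) * x.a t i := by linarith
  exact nonneg_of_mul_nonneg_right h4 (Real.exp_pos _)

lemma continuousOn_q : ContinuousOn x.q x.J := fun t ht => (x.q_deriv t ht).continuousWithinAt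

lemma continuousOn_w : ContinuousOn x.w x.J := fun t ht => (x.w_deriv t ht).continuousWithinAt

lemma continuousOn_v (ht : t ∈ x.J) : ContinuousOn x.v (Set.Icc x.t0 t) := by
  have h := (x.v_ac t ht).continuousOn
  rwa [Set.uIcc_of_le (x.t0_le ht)] at h

lemma ac_β (ht : t ∈ x.J) (i : Fin m) :
    AbsolutelyContinuousOnInterval (fun s => D.β (x.q s) (x.v s) (x.w s) i) x.t0 t := by
  have hsub := x.Icc_subset x.t0_mem ht
  refine (absolutelyContinuous_mulVec D.A (absolutelyContinuous_apply (x.v_ac t ht)) i).fun_sub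
    (absolutelyContinuous_of_hasDerivWithinAt (x.t0_le ht)
      (f' := fun s => D.b (x.q s) (x.v s) (x.w s) i) (fun s hs => ?_) ?_)
  · exact hasDerivWithinAt_pi.1 (D.hasDerivWithinAt_χs ((x.q_deriv s (hsub hs)).mono hsub)
      ((x.w_deriv s (hsub hs)).mono hsub)) i
  · have h := D.continuous_b.comp_continuousOn ((x.continuousOn_q.mono hsub).prodMk
      ((x.continuousOn_v ht).prodMk (x.continuousOn_w.mono hsub)))
    exact (continuous_apply i).comp_continuousOn h

/-- The Lyapunov function along a trajectory. -/
noncomputable def energy (ρ : ℝ) (α : Vec k) (t : ℝ) : ℝ :=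
  D.lyapunov ρ (D.β (x.q t) (x.v t) (x.w t)) (x.a t - α)

lemma ac_energy (ha : a ∈ x.J) (hb : b ∈ x.J) (hab : a ≤ b) :
    AbsolutelyContinuousOnInterval (x.energy ρ α) a b := by
  refine x.ac_mono ?_ ha hb hab
  have he : ∀ i, AbsolutelyContinuousOnInterval (fun s => (x.a s - α) i) x.t0 b := fun i =>
    (absolutelyContinuous_apply (x.a_ac b hb) i).fun_sub (absolutelyContinuous_const (α i))
  exact (absolutelyContinuous_dotProduct (x.ac_β hb)
    (absolutelyContinuous_mulVec D.P (x.ac_β hb))).fun_add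
    ((absolutelyContinuous_dotProduct he he).const_mul _)

lemma energy_rate (hlam : 0 < lam) (hgain : D.NominalGainBound lam) (hρ : -1 < ρ)
    (hW : D.InputUncertaintyBound S ρ) (henv : D.EnvelopeBound S ρ α) (ha : a ∈ x.J)
    (hb : b ∈ x.J) : ∀ᵐ t, t ∈ Set.Ioo a b → ∃ V', HasDerivAt (x.energy ρ α) V' t ∧
      V' ≤ -(D.K1 lam ρ * x.combinedError α t ^ 2 - D.K2 ρ α * x.combinedError α t
        - D.K3 ρ α) := by
  filter_upwards [x.ae_Ioo x.dynamics ha hb, x.ae_Ioo x.adaptation ha hb] with t h1 h2 hmem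
  obtain ⟨hJ, hnhds, acc, hv, hdyn⟩ := h1 hmem
  obtain ⟨-, -, hada⟩ := h2 hmem
  have hβ : HasDerivAt (fun s => D.β (x.q s) (x.v s) (x.w s))
      (D.A *ᵥ acc - D.b (x.q t) (x.v t) (x.w t)) t :=
    (hasDerivAt_mulVec D.A hv).sub
      ((D.hasDerivWithinAt_χs (x.q_deriv t hJ) (x.w_deriv t hJ)).hasDerivAt hnhds)
  have he := hada.sub_const α
  refine ⟨_, (hasDerivAt_dotProduct hβ (hasDerivAt_mulVec D.P hβ)).add
    ((hasDerivAt_dotProduct he he).const_mul (D.l1⁻¹ * (1 + ρ))), ?_⟩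
  refine le_trans (le_of_eq ?_) (lyapunov_rate_le hlam hgain hρ hW henv (x.nonneg_of_mem hJ)
    (x.σ_mem t hJ) (x.a_nonneg hJ) hdyn)
  have hsymm : ∀ y z : Vec m, y ⬝ᵥ D.P *ᵥ z = z ⬝ᵥ D.P *ᵥ y := fun y z => by
    rw [dotProduct_mulVec, dotProduct_comm, ← mulVec_transpose, P_transpose]
  rw [hsymm (_ - _), dotProduct_comm (D.adaptRhs _ _ _ _ _)]
  ring

end Trajectory

/-! ### The decay estimates for the combined error -/

lemma K1_pos (hlam : 0 < lam) (hρ : -1 < ρ) : 0 < D.K1 lam ρ := by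
  have : 0 < 1 + ρ := by linarith
  have := D.κ_pos
  have := D.l1_pos
  have := D.l2_pos
  exact lt_min (by positivity) (by positivity)

lemma K2_nonneg (hρ : -1 < ρ) : 0 ≤ D.K2 ρ α := by
  have : 0 < 1 + ρ := by linarith
  have := D.l1_pos
  have := D.l2_pos
  have := nrm_nonneg α
  unfold K2
  positivity

lemma K3_pos (hρ : -1 < ρ) : 0 < D.K3 ρ α := by
  have : 0 < 1 + ρ := by linarith
  have := D.μ_pos
  have := D.ε_pos
  have := nrm_nonneg α
  unfold K3
  positivity

lemma R_root (hlam : 0 < lam) (hρ : -1 < ρ) :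
    0 < D.R lam ρ α ∧
      D.K1 lam ρ * D.R lam ρ α ^ 2 = D.K2 ρ α * D.R lam ρ α + D.K3 ρ α := by
  have h1 := K1_pos (D := D) hlam hρ
  have h2 := K2_nonneg (D := D) (α := α) hρ
  have h3 := K3_pos (D := D) (α := α) hρ
  have hd : 0 < D.K2 ρ α ^ 2 + 4 * D.K1 lam ρ * D.K3 ρ α := by positivity
  have hs := Real.sqrt_pos.2 hd
  have hsq := Real.sq_sqrt hd.le
  refine ⟨by unfold R; positivity, ?_⟩
  unfold R
  generalize Real.sqrt (D.K2 ρ α ^ 2 + 4 * D.K1 lam ρ * D.K3 ρ α) = s at *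
  field_simp
  nlinarith

/-- The decay rate `K1 N² - K2 N - K3` is increasing in `N` beyond its root `R`. -/
lemma rate_mono (hlam : 0 < lam) (hρ : -1 < ρ) {x y : ℝ} (hx : D.R lam ρ α ≤ x) (hxy : x ≤ y) :
    D.K1 lam ρ * x ^ 2 - D.K2 ρ α * x - D.K3 ρ α ≤
      D.K1 lam ρ * y ^ 2 - D.K2 ρ α * y - D.K3 ρ α := by
  obtain ⟨hR, hroot⟩ := R_root (D := D) (α := α) hlam hρ
  have h1 := K1_pos (D := D) hlam hρ
  have h3 := K3_pos (D := D) (α := α) hρ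
  have h4 : D.K2 ρ α ≤ D.K1 lam ρ * D.R lam ρ α := by
    by_contra! h
    nlinarith
  have h5 : D.K2 ρ α ≤ D.K1 lam ρ * (x + y) := by nlinarith
  nlinarith [mul_le_mul_of_nonneg_right h5 (sub_nonneg.2 hxy)]

lemma rate_pos (hlam : 0 < lam) (hρ : -1 < ρ) {x : ℝ} (hx : D.R lam ρ α < x) :
    0 < D.K1 lam ρ * x ^ 2 - D.K2 ρ α * x - D.K3 ρ α := by
  obtain ⟨hR, hroot⟩ := R_root (D := D) (α := α) hlam hρ
  have h1 := K1_pos (D := D) hlam hρ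
  have h3 := K3_pos (D := D) (α := α) hρ
  have h4 : D.K2 ρ α ≤ D.K1 lam ρ * D.R lam ρ α := by
    by_contra! h
    nlinarith
  have h5 : D.K2 ρ α < D.K1 lam ρ * (x + D.R lam ρ α) := by nlinarith
  nlinarith [mul_lt_mul_of_pos_right h5 (sub_pos.2 hx)]

namespace Trajectory

variable (x : Trajectory D S) {a b t : ℝ}

lemma combinedError_nonneg (t : ℝ) : 0 ≤ x.combinedError α t := nrm_nonneg _

/-- The combined error cannot leave a sublevel set of the Lyapunov function that contains the ball
of radius `R`, from any time on. -/
lemma combinedError_le (hm : 0 < m) (hlam : 0 < lam) (hgain : D.NominalGainBound lam)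
    (hρ : -1 < ρ) (hW : D.InputUncertaintyBound S ρ) (henv : D.EnvelopeBound S ρ α)
    (ha : a ∈ x.J) (hb : b ∈ x.J) (hab : a ≤ b) :
    x.combinedError α b ≤
      Real.sqrt (D.X2 ρ / D.X1 ρ) * max (D.R lam ρ α) (x.combinedError α a) := by
  have hX1 := X1_pos (D := D) hm hρ
  have hX2 := hX1.trans_le (D.X1_le_X2 ρ)
  have hR := (R_root (D := D) (α := α) hlam hρ).1
  obtain ⟨r, hr⟩ : ∃ r, r = max (D.R lam ρ α) (x.combinedError α a) := ⟨_, rfl⟩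
  have hrR : D.R lam ρ α ≤ r := hr ▸ le_max_left _ _
  have hra : x.combinedError α a ≤ r := hr ▸ le_max_right _ _
  have hupper : ∀ s, x.energy ρ α s ≤ D.X2 ρ * x.combinedError α s ^ 2 :=
    fun s => D.lyapunov_le_X2_mul ρ _ _
  rw [← hr]
  have hV : x.energy ρ α b ≤ D.X2 ρ * r ^ 2 := by
    refine le_of_deriv_nonpos_above hab (x.ac_energy ha hb hab)
      ((hupper a).trans ?_) ?_
    · have := x.combinedError_nonneg (α := α) a
      gcongr
    · filter_upwards [x.energy_rate hlam hgain hρ hW henv ha hb] with t ht hmem hgt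
      obtain ⟨V', hV', hle⟩ := ht hmem
      refine ⟨V', hV', hle.trans (neg_nonpos.2 (rate_pos hlam hρ (hrR.trans_lt ?_)).le)⟩
      have h1 := lt_of_mul_lt_mul_left (hgt.trans_le (hupper t)) hX2.le
      exact lt_of_pow_lt_pow_left₀ 2 (x.combinedError_nonneg t) h1
  have hlow : D.X1 ρ * x.combinedError α b ^ 2 ≤ x.energy ρ α b := D.X1_mul_le_lyapunov ρ _ _
  have hr0 : 0 ≤ r := hR.le.trans hrR
  refine abs_le_of_sq_le_sq' ?_ (by positivity) |>.2
  rw [mul_pow, Real.sq_sqrt (by positivity), div_mul_eq_mul_div, le_div_iff₀ hX1]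
  linarith

/-- The combined error enters every ball of radius larger than `√(X2 / X1) R` within the time
`reachTime`: as long as it exceeds `d √(X1 / X2) > R`, the Lyapunov function decreases at a rate
that is bounded away from zero. -/
lemma combinedError_le_of_reachTime (hm : 0 < m) (hlam : 0 < lam)
    (hgain : D.NominalGainBound lam) (hρ : -1 < ρ) (hW : D.InputUncertaintyBound S ρ)
    (henv : D.EnvelopeBound S ρ α) {d s : ℝ}
    (hd : Real.sqrt (D.X2 ρ / D.X1 ρ) * D.R lam ρ α < d) (hs : x.combinedError α x.t0 ≤ s)
    (ht : t ∈ x.J) (hT : x.t0 + D.reachTime lam ρ α d s ≤ t) : x.combinedError α t ≤ d := by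
  have hX1 := X1_pos (D := D) hm hρ
  have hX2 := hX1.trans_le (D.X1_le_X2 ρ)
  have hR := (R_root (D := D) (α := α) hlam hρ).1
  have hd0 : 0 < d := lt_of_le_of_lt (by positivity) hd
  obtain ⟨r, hr⟩ : ∃ r, r = d * Real.sqrt (D.X1 ρ / D.X2 ρ) := ⟨_, rfl⟩
  have hr0 : 0 < r := by rw [hr]; positivity
  have hinv : Real.sqrt (D.X2 ρ / D.X1 ρ) * Real.sqrt (D.X1 ρ / D.X2 ρ) = 1 := by
    rw [← Real.sqrt_mul (by positivity), div_mul_div_cancel₀ hX1.ne', div_self hX2.ne',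
      Real.sqrt_one]
  have hdr : Real.sqrt (D.X2 ρ / D.X1 ρ) * r = d := by
    rw [hr, mul_left_comm, hinv, mul_one]
  have hRr : D.R lam ρ α < r := by
    rw [← hdr] at hd
    exact lt_of_mul_lt_mul_left hd (Real.sqrt_nonneg _)
  have hr2 : r ^ 2 = d ^ 2 * (D.X1 ρ / D.X2 ρ) := by
    rw [hr, mul_pow, Real.sq_sqrt (by positivity)]
  -- it suffices to reach the radius `r` at some earlier time
  have hreach : ∀ u ∈ x.J, u ≤ t → x.combinedError α u ≤ r → x.combinedError α t ≤ d := by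
    intro u hu hut hur
    refine (x.combinedError_le hm hlam hgain hρ hW henv hu ht hut).trans ?_
    rw [← hdr]
    gcongr
    exact max_le hRr.le hur
  unfold reachTime at hT
  rw [← hr] at hT
  split_ifs at hT with hsr
  · exact hreach _ x.t0_mem (x.t0_le ht) (hs.trans hsr)
  · have hden : D.K1 lam ρ * d ^ 2 * (D.X1 ρ / D.X2 ρ)
        - D.K2 ρ α * d * Real.sqrt (D.X1 ρ / D.X2 ρ) - D.K3 ρ α
        = D.K1 lam ρ * r ^ 2 - D.K2 ρ α * r - D.K3 ρ α := by
      rw [hr2, hr]; ring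
    have hnum : D.X2 ρ * s ^ 2 - D.X1 ρ ^ 2 / D.X2 ρ * d ^ 2
        = D.X2 ρ * s ^ 2 - D.X1 ρ * r ^ 2 := by
      rw [hr2]; ring
    rw [hden, hnum] at hT
    have hrate := rate_pos (D := D) (α := α) hlam hρ hRr
    obtain ⟨c, hc⟩ : ∃ c, c = D.K1 lam ρ * r ^ 2 - D.K2 ρ α * r - D.K3 ρ α := ⟨_, rfl⟩
    rw [← hc] at hT hrate
    have hs0 : 0 ≤ s := (x.combinedError_nonneg _).trans hs
    have hT0 : 0 ≤ (D.X2 ρ * s ^ 2 - D.X1 ρ * r ^ 2) / c := by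
      refine div_nonneg (sub_nonneg.2 ?_) hrate.le
      have := D.X1_le_X2 ρ
      have := (not_le.1 hsr).le
      gcongr
    obtain ⟨T, hTdef⟩ : ∃ T, T = (D.X2 ρ * s ^ 2 - D.X1 ρ * r ^ 2) / c := ⟨_, rfl⟩
    rw [← hTdef] at hT hT0
    by_contra! hcon
    have habove : ∀ u ∈ x.J, u ≤ t → r < x.combinedError α u := fun u hu hut => by
      by_contra! h
      exact absurd (hreach u hu hut h) (not_le.2 hcon)
    have hmem : x.t0 + T ∈ x.J := x.Icc_subset x.t0_mem ht ⟨by linarith, hT⟩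
    have hdec := sub_le_of_ae_deriv_le (c := -c) (by linarith)
      (x.ac_energy (ρ := ρ) (α := α) x.t0_mem hmem (by linarith)) (by
        filter_upwards [x.energy_rate hlam hgain hρ hW henv x.t0_mem hmem] with u hu hmu
        obtain ⟨V', hV', hle⟩ := hu hmu
        refine ⟨V', hV', hle.trans (neg_le_neg ?_)⟩
        rw [hc]
        exact rate_mono hlam hρ hRr.le (habove u (x.Icc_subset x.t0_mem hmem
          (Set.Ioo_subset_Icc_self hmu)) (hmu.2.le.trans hT)).le)
    have h1 : x.energy ρ α x.t0 ≤ D.X2 ρ * s ^ 2 := by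
      refine (D.lyapunov_le_X2_mul ρ _ _).trans ?_
      have := x.combinedError_nonneg (α := α) x.t0
      change D.X2 ρ * x.combinedError α x.t0 ^ 2 ≤ _
      gcongr
    have h2 : D.X1 ρ * x.combinedError α (x.t0 + T) ^ 2 ≤ x.energy ρ α (x.t0 + T) :=
      D.X1_mul_le_lyapunov ρ _ _
    have h3 : c * T = D.X2 ρ * s ^ 2 - D.X1 ρ * r ^ 2 := by
      rw [hTdef, mul_div_cancel₀ _ hrate.ne']
    have h4 := habove _ hmem hT
    have h5 : D.X1 ρ * r ^ 2 < D.X1 ρ * x.combinedError α (x.t0 + T) ^ 2 := by gcongr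
    nlinarith

end Trajectory

/-! ### The path-following error -/

/-- The path functions are Lipschitz and vanish on the lifted path, so that they are controlled by
the distance to it. -/
lemma exists_nrm_φ_le (hm : 0 < m) (D : Design n m k) :
    ∃ L : ℝ, 0 < L ∧ ∀ ξ, nrm (D.φ ξ) ≤ L * distTo ξ D.pathHgh := by
  obtain ⟨e, he, hbd⟩ := D.f_deriv_bdd
  have hm' : (0 : ℝ) < m := Nat.cast_pos.2 hm
  have hL : 0 < m * (1 + e) := by positivity
  refine ⟨m * (1 + e), hL, fun ξ => ?_⟩
  rw [← div_le_iff₀' hL]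
  refine le_csInf (Set.Nonempty.image _ ⟨DesiredPath.ext (fun i => D.f i 0) 0, fun i => ?_⟩) ?_
  · simp [DesiredPath.φ, DesiredPath.ext]
  rintro _ ⟨ξ', hξ', rfl⟩
  rw [div_le_iff₀' hL]
  have hi : ∀ i, |D.φ ξ i| ≤ (1 + e) * nrm (ξ - ξ') := fun i => by
    have h0 : D.φ ξ i = (ξ - ξ') (Sum.inl i)
        - (D.f i (ξ (Sum.inr ())) - D.f i (ξ' (Sum.inr ()))) := by
      have h := hξ' i
      simp only [DesiredPath.φ, Pi.sub_apply] at h ⊢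
      linarith
    have h1 := abs_le_nrm (ξ - ξ') (Sum.inl i)
    have h2 := abs_le_nrm (ξ - ξ') (Sum.inr ())
    have h3 : |D.f i (ξ (Sum.inr ())) - D.f i (ξ' (Sum.inr ()))|
        ≤ e * |(ξ - ξ') (Sum.inr ())| :=
      convex_univ.norm_image_sub_le_of_norm_deriv_le
        (fun z _ => (D.hasDerivAt_f i z).differentiableAt) (fun z _ => hbd i z)
        (Set.mem_univ _) (Set.mem_univ _)
    rw [h0]
    refine (abs_sub _ _).trans ?_
    nlinarith
  calc nrm (D.φ ξ) ≤ ∑ i, |D.φ ξ i| := nrm_le_sum_abs _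
    _ ≤ ∑ _i : Fin m, (1 + e) * nrm (ξ - ξ') := Finset.sum_le_sum fun i _ => hi i
    _ = m * (1 + e) * nrm (ξ - ξ') := by simp [mul_assoc]

lemma exists_gain_lower_bound (D : Design n m k) : ∃ c : ℝ, 0 < c ∧ ∀ i, c ≤ D.kf i := by
  rcases isEmpty_or_nonempty (Fin m) with h | h
  · exact ⟨1, one_pos, fun i => (h.false i).elim⟩
  · obtain ⟨i, hi⟩ := Finite.exists_min D.kf
    exact ⟨D.kf i, D.kf_pos i, hi⟩

/-- The weighted square sum `½ ∑ k_i φ_i²` of the path functions, the Lyapunov function of the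
guiding vector field. -/
noncomputable def pathEnergy (D : Design n m k) (ζ : Vec m) (w : ℝ) : ℝ :=
  1 / 2 * ∑ i, D.kf i * D.φ (DesiredPath.ext ζ w) i ^ 2

lemma pathEnergy_le (D : Design n m k) (ζ : Vec m) (w : ℝ) :
    D.pathEnergy ζ w ≤ 1 / 2 * (∑ i, D.kf i) * nrm (D.φ (DesiredPath.ext ζ w)) ^ 2 := by
  rw [pathEnergy, mul_assoc, Finset.sum_mul]
  refine mul_le_mul_of_nonneg_left (Finset.sum_le_sum fun i _ => ?_) (by norm_num)
  exact mul_le_mul_of_nonneg_left (sq_le_sq.2 ((abs_le_nrm _ i).trans (le_abs_self _)))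
    (D.kf_pos i).le

lemma mul_nrm_φ_sq_le {c : ℝ} (hc : ∀ i, c ≤ D.kf i) (ζ : Vec m) (w : ℝ) :
    c / 2 * nrm (D.φ (DesiredPath.ext ζ w)) ^ 2 ≤ D.pathEnergy ζ w := by
  rw [pathEnergy, nrm_sq, dotProduct, div_mul_eq_mul_div, Finset.mul_sum, one_div_mul_eq_div]
  refine div_le_div_of_nonneg_right (Finset.sum_le_sum fun i _ => ?_) zero_le_two
  rw [← sq]
  exact mul_le_mul_of_nonneg_right (hc i) (sq_nonneg _)

/-- Along the guiding vector field perturbed by `y`, the path energy decays exponentially up to a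
term that is quadratic in `y`: the propagation terms `(-1) ^ m f'` cancel. -/
lemma pathEnergy_rate_le {c : ℝ} (hc : ∀ i, c ≤ D.kf i) (ζ y : Vec m) (w : ℝ) :
    ∑ i, D.kf i * D.φ (DesiredPath.ext ζ w) i *
        (y i + D.χs ζ w i - deriv (D.f i) w * D.χw ζ w)
      ≤ 1 / 2 * nrm y ^ 2 - c * D.pathEnergy ζ w := by
  obtain ⟨s, hs⟩ : ∃ s, s = ∑ i, D.kf i * D.φ (DesiredPath.ext ζ w) i * deriv (D.f i) w :=
    ⟨_, rfl⟩
  have h1 : ∑ i, D.kf i * D.φ (DesiredPath.ext ζ w) i *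
        (y i + D.χs ζ w i - deriv (D.f i) w * D.χw ζ w)
      = ∑ i, D.kf i * D.φ (DesiredPath.ext ζ w) i *
          (y i - D.kf i * D.φ (DesiredPath.ext ζ w) i) - s * s := by
    rw [χw, ← hs]
    nth_rewrite 2 [hs]
    rw [Finset.sum_mul, ← Finset.sum_sub_distrib]
    refine Finset.sum_congr rfl fun i _ => ?_
    rw [χs]
    ring
  rw [h1, nrm_sq, pathEnergy, dotProduct, Finset.mul_sum, Finset.mul_sum, Finset.mul_sum,
    ← Finset.sum_sub_distrib]
  have h2 : ∑ i, D.kf i * D.φ (DesiredPath.ext ζ w) i *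
        (y i - D.kf i * D.φ (DesiredPath.ext ζ w) i)
      ≤ ∑ i, (1 / 2 * (y i * y i)
          - c * (1 / 2 * (D.kf i * D.φ (DesiredPath.ext ζ w) i ^ 2))) := by
    refine Finset.sum_le_sum fun i _ => ?_
    generalize D.φ (DesiredPath.ext ζ w) i = z
    have h3 := mul_le_mul_of_nonneg_right (hc i) (mul_nonneg (D.kf_pos i).le (sq_nonneg z))
    nlinarith [sq_nonneg (y i - D.kf i * z)]
  nlinarith [mul_self_nonneg s]

namespace Trajectory

variable (x : Trajectory D S) {a b t : ℝ}

lemma pathError_le (t : ℝ) :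
    x.pathError t ≤ nrm (D.φ (DesiredPath.ext (x.ζ t) (x.w t))) := by
  have hmem : (fun i => D.f i (x.w t)) ∈ D.path := by
    have : (fun i => D.f i (x.w t)) ∈ Set.range (fun w i => D.f i w) := ⟨x.w t, rfl⟩
    rwa [← D.parametrized] at this
  exact distTo_le hmem

lemma hasDerivWithinAt_pathEnergy (ht : t ∈ x.J) :
    HasDerivWithinAt (fun s => D.pathEnergy (x.ζ s) (x.w s))
      (∑ i, D.kf i * D.φ (DesiredPath.ext (x.ζ t) (x.w t)) i *
        (D.β (x.q t) (x.v t) (x.w t) i + D.χs (x.ζ t) (x.w t) i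
          - deriv (D.f i) (x.w t) * D.χw (x.ζ t) (x.w t))) x.J t := by
  have h : ∀ i, HasDerivWithinAt (fun s => D.φ (DesiredPath.ext (x.ζ s) (x.w s)) i)
      (D.β (x.q t) (x.v t) (x.w t) i + D.χs (x.ζ t) (x.w t) i
        - deriv (D.f i) (x.w t) * D.χw (x.ζ t) (x.w t)) x.J t := fun i => by
    have h1 := hasDerivWithinAt_pi.1 (hasDerivWithinAt_mulVec D.A (x.q_deriv t ht)) i
    have h2 := (D.hasDerivAt_f i (x.w t)).comp_hasDerivWithinAt t (x.w_deriv t ht)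
    refine (h1.sub h2).congr_deriv ?_
    simp [β, ζ]
  refine ((HasDerivWithinAt.fun_sum (u := Finset.univ) fun i _ =>
    ((h i).pow 2).const_mul (D.kf i)).const_mul (1 / 2)).congr_deriv ?_
  rw [Finset.mul_sum]
  refine Finset.sum_congr rfl fun i _ => ?_
  ring

/-- Exponential decay of the path energy towards the level `B / (2 c)` while `‖β‖² ≤ B`. -/
lemma pathEnergy_decay {c B : ℝ} (hc0 : 0 < c) (hc : ∀ i, c ≤ D.kf i) (ha : a ∈ x.J)
    (hb : b ∈ x.J) (hab : a ≤ b)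
    (hB : ∀ t ∈ Set.Icc a b, nrm (D.β (x.q t) (x.v t) (x.w t)) ^ 2 ≤ B) :
    D.pathEnergy (x.ζ b) (x.w b)
      ≤ Real.exp (-(c * (b - a))) * D.pathEnergy (x.ζ a) (x.w a) + B / (2 * c) := by
  have hsub := x.Icc_subset ha hb
  have hd : ∀ t ∈ Set.Icc a b, HasDerivWithinAt
      (fun s => Real.exp (c * s) * (D.pathEnergy (x.ζ s) (x.w s) - B / (2 * c)))
      (Real.exp (c * t) * c * (D.pathEnergy (x.ζ t) (x.w t) - B / (2 * c)) + Real.exp (c * t) *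
        (∑ i, D.kf i * D.φ (DesiredPath.ext (x.ζ t) (x.w t)) i *
        (D.β (x.q t) (x.v t) (x.w t) i + D.χs (x.ζ t) (x.w t) i
          - deriv (D.f i) (x.w t) * D.χw (x.ζ t) (x.w t)))) (Set.Icc a b) t := fun t ht => by
    have h1 : HasDerivAt (fun s => Real.exp (c * s)) (Real.exp (c * t) * c) t := by
      simpa using ((hasDerivAt_id t).const_mul c).exp
    exact h1.hasDerivWithinAt.mul
      (((x.hasDerivWithinAt_pathEnergy (hsub ht)).mono hsub).sub_const _)
  have hanti := antitoneOn_of_hasDerivWithinAt_nonpos (convex_Icc a b)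
    (fun t ht => (hd t ht).continuousWithinAt)
    (fun t ht => (hd t (interior_subset ht)).mono interior_subset) (fun t ht => by
      have h1 := D.pathEnergy_rate_le hc (x.ζ t) (D.β (x.q t) (x.v t) (x.w t)) (x.w t)
      have h2 := hB t (interior_subset ht)
      have h3 : c * (B / (2 * c)) = B / 2 := by field_simp
      rw [mul_assoc, ← mul_add]
      refine mul_nonpos_of_nonneg_of_nonpos (Real.exp_pos _).le ?_
      rw [mul_sub, h3]
      linarith)
  have h := hanti ⟨le_rfl, hab⟩ ⟨hab, le_rfl⟩ hab
  have hB0 : 0 ≤ B / (2 * c) :=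
    div_nonneg ((sq_nonneg _).trans (hB a ⟨le_rfl, hab⟩)) (by positivity)
  have hexp : Real.exp (-(c * (b - a))) * Real.exp (c * b) = Real.exp (c * a) := by
    rw [← Real.exp_add]; congr 1; ring
  simp only at h
  rw [← hexp, mul_comm _ (Real.exp (c * b)), mul_assoc] at h
  have h4 := le_of_mul_le_mul_left h (Real.exp_pos _)
  nlinarith [mul_nonneg (Real.exp_pos (-(c * (b - a)))).le hB0]

lemma nrm_β_sq_le {e : ℝ} (h : x.combinedError α t ≤ e) :
    nrm (D.β (x.q t) (x.v t) (x.w t)) ^ 2 ≤ e ^ 2 :=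
  pow_le_pow_left₀ (nrm_nonneg _) ((nrm_left_le _ (x.a t - α)).trans h) 2

end Trajectory

/-- The path-following error is uniformly ultimately bounded: `β` is bounded from the start and
ultimately small, and acts as a perturbation of the guiding vector field. -/
lemma uniformlyUltimatelyBounded_pathError (hm : 0 < m) (hlam : 0 < lam)
    (hgain : D.NominalGainBound lam) (hρ : -1 < ρ) (hW : D.InputUncertaintyBound S ρ)
    (henv : D.EnvelopeBound S ρ α) :
    D.UniformlyUltimatelyBounded S α (fun x t => x.pathError t) := by
  obtain ⟨L, hL, hφ⟩ := D.exists_nrm_φ_le hm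
  obtain ⟨c, hc0, hc⟩ := D.exists_gain_lower_bound
  obtain ⟨d, hd⟩ := exists_gt (Real.sqrt (D.X2 ρ / D.X1 ρ) * D.R lam ρ α)
  have hU : 0 < 2 / c * (1 + d ^ 2 / (2 * c)) := by positivity
  refine ⟨Real.sqrt (2 / c * (1 + d ^ 2 / (2 * c))), Real.sqrt_pos.2 hU, fun r hr => ?_⟩
  have hk : 0 ≤ ∑ i, D.kf i := Finset.sum_nonneg fun i _ => (D.kf_pos i).le
  -- a bound of the path energy at the time when `β` has become small
  obtain ⟨E, hE⟩ : ∃ E, E = 1 / 2 * (∑ i, D.kf i) * (L * r) ^ 2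
    + (Real.sqrt (D.X2 ρ / D.X1 ρ) * max (D.R lam ρ α) r) ^ 2 / (2 * c) := ⟨_, rfl⟩
  have hE0 : 0 ≤ E := by rw [hE]; positivity
  obtain ⟨T, hT⟩ : ∃ T, T = max 0 (D.reachTime lam ρ α d r) := ⟨_, rfl⟩
  have hT0 : 0 ≤ T := hT ▸ le_max_left _ _
  refine ⟨T + E / c, by positivity, fun x hx t ht htT => ?_⟩
  have hx1 : x.combinedError α x.t0 ≤ r := (le_max_left _ _).trans hx
  have hx2 : x.liftedPathError x.t0 ≤ r := (le_max_right _ _).trans hx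
  have hEc : 0 ≤ E / c := by positivity
  have hmem : x.t0 + T ∈ x.J := x.Icc_subset x.t0_mem ht ⟨by linarith, by linarith⟩
  have hstart : D.pathEnergy (x.ζ x.t0) (x.w x.t0) ≤ 1 / 2 * (∑ i, D.kf i) * (L * r) ^ 2 := by
    refine (D.pathEnergy_le _ _).trans ?_
    have := nrm_nonneg (D.φ (DesiredPath.ext (x.ζ x.t0) (x.w x.t0)))
    gcongr
    exact (hφ _).trans (mul_le_mul_of_nonneg_left hx2 hL.le)
  have hmid : D.pathEnergy (x.ζ (x.t0 + T)) (x.w (x.t0 + T)) ≤ E := by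
    have h := x.pathEnergy_decay hc0 hc x.t0_mem hmem (by linarith) (fun s hs =>
      x.nrm_β_sq_le ((x.combinedError_le hm hlam hgain hρ hW henv x.t0_mem
        (x.Icc_subset x.t0_mem hmem hs) hs.1).trans (mul_le_mul_of_nonneg_left
          (max_le_max_left _ hx1) (Real.sqrt_nonneg _))))
    have h1 : Real.exp (-(c * (x.t0 + T - x.t0))) ≤ 1 := by
      rw [Real.exp_le_one_iff, add_sub_cancel_left]
      exact neg_nonpos.2 (by positivity)
    have h2 : 0 ≤ 1 / 2 * (∑ i, D.kf i) * (L * r) ^ 2 := by positivity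
    have h3 := mul_le_mul_of_nonneg_left hstart
      (Real.exp_pos (-(c * (x.t0 + T - x.t0)))).le
    have h4 := mul_le_mul_of_nonneg_right h1 h2
    rw [hE]
    linarith
  have hend : D.pathEnergy (x.ζ t) (x.w t) ≤ 1 + d ^ 2 / (2 * c) := by
    have h := x.pathEnergy_decay hc0 hc hmem ht (by linarith) (fun s hs =>
      x.nrm_β_sq_le (x.combinedError_le_of_reachTime hm hlam hgain hρ hW henv hd hx1
        (x.Icc_subset hmem ht hs) (le_trans (by rw [hT]; gcongr; exact le_max_right _ _) hs.1)))
    refine h.trans (add_le_add_left ?_ _)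
    -- `exp (-E) E ≤ 1`
    have h1 : Real.exp (-(c * (t - (x.t0 + T)))) ≤ Real.exp (-E) := by
      rw [Real.exp_le_exp, neg_le_neg_iff, ← div_le_iff₀' hc0]
      linarith
    have h2 : Real.exp (-E) * E ≤ 1 := by
      rw [Real.exp_neg, inv_mul_le_iff₀ (Real.exp_pos _), mul_one]
      linarith [Real.add_one_le_exp E]
    calc _ ≤ Real.exp (-(c * (t - (x.t0 + T)))) * E :=
          mul_le_mul_of_nonneg_left hmid (Real.exp_pos _).le
      _ ≤ Real.exp (-E) * E := mul_le_mul_of_nonneg_right h1 hE0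
      _ ≤ 1 := h2
  refine (x.pathError_le t).trans (Real.le_sqrt_of_sq_le ?_)
  have h := (D.mul_nrm_φ_sq_le hc (x.ζ t) (x.w t)).trans hend
  rw [div_mul_eq_mul_div, le_div_iff₀' hc0]
  linarith

lemma uniformlyUltimatelyBounded_adaptiveError (hm : 0 < m) (hlam : 0 < lam)
    (hgain : D.NominalGainBound lam) (hρ : -1 < ρ) (hW : D.InputUncertaintyBound S ρ)
    (henv : D.EnvelopeBound S ρ α) :
    D.UniformlyUltimatelyBounded S α (fun x t => x.adaptiveError α t) := by
  obtain ⟨d, hd⟩ := exists_gt (Real.sqrt (D.X2 ρ / D.X1 ρ) * D.R lam ρ α)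
  have hR := (R_root (D := D) (α := α) hlam hρ).1
  refine ⟨d, lt_of_le_of_lt (by positivity) hd, fun r _ =>
    ⟨max 0 (D.reachTime lam ρ α d r), le_max_left _ _, fun x hx t ht htT => ?_⟩⟩
  refine (nrm_right_le (D.β (x.q t) (x.v t) (x.w t)) _).trans ?_
  exact x.combinedError_le_of_reachTime hm hlam hgain hρ hW henv hd
    ((le_max_left _ _).trans hx) ht (le_trans (by gcongr; exact le_max_right _ _) htT)

end Design
end PathFollowing

theorem theorem2 {n m p k : ℕ} (hm : 0 < m) (hk : 0 < k)
    (S : PathFollowing.UncertainSystem n m p) (D : PathFollowing.Design n m k)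
    (lam ρ : ℝ) (α : PathFollowing.Vec k)
    (hrad : D.RadiallyBounded)
    (hlam : 0 < lam) (hgain : D.NominalGainBound lam)
    (hρ : -1 < ρ) (hW : D.InputUncertaintyBound S ρ)
    (hα : ∀ i, 0 < α i) (henv : D.EnvelopeBound S ρ α) :
    D.UniformlyUltimatelyBounded S α (fun x t => x.pathError t) ∧
    D.UniformlyUltimatelyBounded S α (fun x t => x.adaptiveError α t) ∧
    (∀ x : PathFollowing.Design.Trajectory D S, ∀ t ∈ x.J,
      x.combinedError α t ≤
        Real.sqrt (D.X2 ρ / D.X1 ρ) * max (D.R lam ρ α) (x.combinedError α x.t0)) ∧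
    (∀ d : ℝ, Real.sqrt (D.X2 ρ / D.X1 ρ) * D.R lam ρ α < d → ∀ s : ℝ,
      ∀ x : PathFollowing.Design.Trajectory D S, x.combinedError α x.t0 ≤ s →
        ∀ t ∈ x.J, x.t0 + D.reachTime lam ρ α d s ≤ t → x.combinedError α t ≤ d) :=
  ⟨PathFollowing.Design.uniformlyUltimatelyBounded_pathError hm hlam hgain hρ hW henv,
    PathFollowing.Design.uniformlyUltimatelyBounded_adaptiveError hm hlam hgain hρ hW henv,
    fun x _ ht => x.combinedError_le hm hlam hgain hρ hW henv x.t0_mem ht (x.t0_le ht),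
    fun _ hd _ x hs _ ht hT =>
      x.combinedError_le_of_reachTime hm hlam hgain hρ hW henv hd hs ht hT⟩
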